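/- Let $M$ be a smooth $n$-dimensional spin manifold (Hausdorff, second countable), with a fixed principal $\mathrm{Spin}(n)$-bundle and its $\mathrm{SO}(n)$-quotient (a reduction of the frame bundle), let $V$ be a nonzero finite-dimensional hermitian complex Clifford module, with self-adjoint Clifford matrices satisfying $\gamma^i\gamma^j+\gamma^j\gamma^i=2\delta^{ij}$, and let $SM$ be the associated bundle of spinors. Let $g$ be a possibly singular Riemannian metric on $M$, given by an $\mathbb R^n$-valued soldering form on the principal bundle, i.e. by local coframes $\tau^a=e_\mu{}^a\,dx^\mu$ in the smooth local trivializations, which are invertible almost everywhere. Assume that outside of a closed set $\mathcal S\subset M$ of measure zero the components $e_\mu{}^a$ in local coordinates are locally $L^1$ and have distributional first partial derivatives that are (locally integrable) functions. Let $e_a=e_a{}^\mu\partial_\mu$ be the dual orthonormal frame, let $\omega^a{}_b=\omega^a{}_{b\mu}dx^\mu$ be the Levi-Civita connection forms, determined by $\omega^a{}_b=-\omega^b{}_a$ and $d\tau^a+\omega^a{}_b\wedge\tau^b=0$, and put $\omega_{abc}=\omega^a{}_{b\mu}e_c{}^\mu$ (orthonormal frame indices are moved up and down freely, repeated indices are summed).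 Let $\mathrm{dvol}_g=\sqrt{\det(g_{\mu\nu})}\,dx^1\cdots dx^n$, with $g_{\mu\nu}=\sum_a e_\mu{}^a e_\nu{}^a$, and for smooth spinor fields put $$\nabla_c\psi=e_c{}^\mu\Big(\partial_\mu\psi+\tfrac18\,\omega_{jk\mu}[\gamma^j,\gamma^k]\psi\Big),\qquad D\psi=-\sqrt{-1}\,\gamma^c\nabla_c\psi .$$ Let $\mathrm{Alt}$ denote antisymmetrization of a $p$-tensor, normalized by $\frac1{p!}$. Then the integral $$\int_M\big(\langle D\eta,D\psi\rangle-\langle\nabla\eta,\nabla\psi\rangle\big)\,\mathrm{dvol}_g$$ is well defined (i.e. its integrand is integrable with respect to $\mathrm{dvol}_g$) for all smooth compactly supported sections $\eta,\psi$ of $SM$ if and only if, in all local coordinates and for all smooth local trivializations of the principal bundle, the following expressions are locally $L^1$ with respect to $\mathrm{dvol}_g$, for all values of the free indices: 1. $e_c{}^\mu e_d{}^\nu-e_d{}^\mu e_c{}^\nu$; 2. $e_c{}^\mu\,\omega^{cd}{}_d$, $\quad -e_a{}^\mu\,\omega_b{}^d{}_d+e_b{}^\mu\,\omega_a{}^d{}_d+e_c{}^\mu\,\omega^c{}_{ab}-e_c{}^\mu\,\omega^c{}_{ba}$,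 $\quad$ and $\ \mathrm{Alt}_{cdef}\big(e_c{}^\mu\,\omega_{efd}\big)$; 3. $\omega^a{}_{ca}\,\omega^{cb}{}_b-\omega^a{}_{cb}\,\omega^{cb}{}_a$ $\quad$ and $\ \mathrm{Alt}_{mnpq}\big(\omega_m{}^r{}_r\,\omega_{pqn}-\omega_{pqr}\,\omega^r{}_{nm}+\omega_{mrp}\,\omega^r{}_{nq}\big)$. -/

import Mathlib

open Set MeasureTheory Manifold
open scoped ContDiff Topology

noncomputable section

/-! ### Euclidean space, its Clifford algebra, hermitian Clifford modules -/

/-- The Euclidean space `ℝⁿ`. -/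
abbrev Euc (n : ℕ) : Type := EuclideanSpace ℝ (Fin n)

/-- The standard basis vector of `ℝⁿ` with index `k`. -/
def stdVec {n : ℕ} (k : Fin n) : Euc n := EuclideanSpace.single k 1

/-- The quadratic form `v ↦ |v|²` on `ℝⁿ`. -/
def euclidQ (n : ℕ) : QuadraticForm ℝ (Euc n) :=
  LinearMap.BilinMap.toQuadraticMap (innerₗ (Euc n))

theorem euclidQ_apply {n : ℕ} (v : Euc n) : euclidQ n v = ‖v‖ ^ 2 := by
  simp [euclidQ]

/-- The real Clifford algebra of `ℝⁿ`, with `v * v = |v|²`. -/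
abbrev Cl (n : ℕ) : Type := CliffordAlgebra (euclidQ n)

/-- The inclusion of `ℝⁿ` into its Clifford algebra. -/
abbrev clVec {n : ℕ} (v : Euc n) : Cl n := CliffordAlgebra.ι (euclidQ n) v

/-- A hermitian Clifford module: a complex representation of the Clifford algebra on a complex
inner product space such that unit vectors act by self-adjoint operators. -/
structure CliffordModule (n : ℕ) (V : Type*) [NormedAddCommGroup V] [InnerProductSpace ℂ V] where
  /-- The representation. -/
  rep : Cl n →ₐ[ℝ] Module.End ℂ V
  symm : ∀ v : Euc n, (rep (clVec v)).IsSymmetric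

/-- The Clifford matrix `γᵏ`. -/
def CliffordModule.gam {n : ℕ} {V : Type*} [NormedAddCommGroup V] [InnerProductSpace ℂ V]
    (R : CliffordModule n V) (k : Fin n) : Module.End ℂ V := R.rep (clVec (stdVec k))

theorem CliffordModule.gam_anticomm {n : ℕ} {V : Type*} [NormedAddCommGroup V]
    [InnerProductSpace ℂ V] (R : CliffordModule n V) (j k : Fin n) :
    R.gam j * R.gam k + R.gam k * R.gam j = if j = k then 2 else 0 := by
  have h := CliffordAlgebra.ι_mul_ι_add_swap (Q := euclidQ n) (stdVec j) (stdVec k)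
  have h2 : QuadraticMap.polar (euclidQ n) (stdVec j) (stdVec k) = if j = k then 2 else 0 := by
    have e : QuadraticMap.polar (euclidQ n) (stdVec j) (stdVec k)
        = 2 * inner ℝ (stdVec j : Euc n) (stdVec k) := by
      simp only [QuadraticMap.polar, euclidQ_apply]
      rw [norm_add_sq_real]; ring
    rw [e]
    by_cases hjk : j = k
    · subst hjk; simp [stdVec]
    · simp [stdVec, EuclideanSpace.inner_single_left, hjk]
  rw [CliffordModule.gam, CliffordModule.gam, ← map_mul R.rep, ← map_mul R.rep, ← map_add R.rep, h, h2]
  split_ifs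
  · simp [map_ofNat]
  · simp

/-- Antisymmetrization of a `p`-tensor, with the normalization factor `1 / p!`. -/
def Alt {n p : ℕ} (T : (Fin p → Fin n) → ℝ) (k : Fin p → Fin n) : ℝ :=
  (p.factorial : ℝ)⁻¹ * ∑ s : Equiv.Perm (Fin p), ((Equiv.Perm.sign s : ℤ) : ℝ) * T (k ∘ s)

/-! ### Coordinates on a manifold -/

section Coordinates

variable {n : ℕ} {M : Type*} [TopologicalSpace M] [ChartedSpace (Euc n) M]

/-- The coordinate vector `∂_μ` of the chart `φ`, at the point with coordinates `y`. -/
def coordVec (φ : OpenPartialHomeomorph M (Euc n)) (y : Euc n) (m : Fin n) :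
    TangentSpace (𝓡 n) (φ.symm y) :=
  mfderiv (𝓡 n) (𝓡 n) φ.symm y (stdVec m : Euc n)

/-- The component `v^μ` of a tangent vector `v` in the chart `φ`. -/
def coordComp (φ : OpenPartialHomeomorph M (Euc n)) {x : M} (v : TangentSpace (𝓡 n) x)
    (m : Fin n) : ℝ :=
  (show Euc n from mfderiv (𝓡 n) (𝓡 n) φ x v) m

/-- The image in the chart `φ` of the part of `W` that lies in the domain of `φ`. -/
def chartRegion (φ : OpenPartialHomeomorph M (Euc n)) (W : Set M) : Set (Euc n) :=
  φ.target ∩ φ.symm ⁻¹' W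

/-- The coordinate volume density `√ det (g_{μν})`, at the point with coordinates `y`, of a field
`g` of bilinear forms on the tangent spaces. -/
def volDensity (g : ∀ x : M, TangentSpace (𝓡 n) x →ₗ[ℝ] TangentSpace (𝓡 n) x →ₗ[ℝ] ℝ)
    (φ : OpenPartialHomeomorph M (Euc n)) (y : Euc n) : ℝ :=
  Real.sqrt (Matrix.det (Matrix.of fun k l : Fin n =>
    g (φ.symm y) (coordVec φ y k) (coordVec φ y l)))

end Coordinates

/-- `h` is the distributional partial derivative `∂_μ f` on the open set `W`, both being locally
integrable functions there. -/
def IsWeakPartial {n : ℕ} (W : Set (Euc n)) (m : Fin n) (f h : Euc n → ℝ) : Prop :=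
  LocallyIntegrableOn f W volume ∧ LocallyIntegrableOn h W volume ∧
    ∀ t : Euc n → ℝ, ContDiff ℝ ∞ t → HasCompactSupport t → tsupport t ⊆ W →
      ∫ y, f y * fderiv ℝ t y (stdVec m) = - ∫ y, h y * t y

theorem measurableSet_image_chart {n : ℕ} {M : Type*} [TopologicalSpace M] [MeasurableSpace M] [BorelSpace M]
    (φ : OpenPartialHomeomorph M (Euc n)) {B : Set M} (hB : MeasurableSet B) :
    MeasurableSet (φ.target ∩ φ.symm ⁻¹' B) := by
  have h : Measurable (φ.target.domRestrict φ.symm) :=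
    (continuousOn_iff_continuous_domRestrict.1 φ.continuousOn_symm).measurable
  have := φ.open_target.measurableSet.subtype_image (h hB)
  convert this using 1
  ext z; simp [Set.domRestrict, and_comm]

/-! ### The volume measure of a field of bilinear forms -/

section Volume

variable {n : ℕ} {M : Type*} [TopologicalSpace M] [ChartedSpace (Euc n) M]

theorem transition_hasFDerivAt {φ ψ : OpenPartialHomeomorph M (Euc n)}
    (hφ : φ ∈ IsManifold.maximalAtlas (𝓡 n) ∞ M) (hψ : ψ ∈ IsManifold.maximalAtlas (𝓡 n) ∞ M)
    {y : Euc n} (hy : y ∈ ψ.target) (hy' : ψ.symm y ∈ φ.source) :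
    HasFDerivAt (fun z => φ (ψ.symm z)) (fderiv ℝ (fun z => φ (ψ.symm z)) y) y ∧
    ∀ v : Euc n, (show Euc n from mfderiv (𝓡 n) (𝓡 n) ψ.symm y v) =
      (show Euc n from mfderiv (𝓡 n) (𝓡 n) φ.symm (φ (ψ.symm y))
        (show Euc n from fderiv ℝ (fun z => φ (ψ.symm z)) y v)) := by
  have h1 : MDifferentiableAt (𝓡 n) (𝓡 n) ψ.symm y :=
    ((contMDiffOn_symm_of_mem_maximalAtlas hψ).contMDiffAt (ψ.open_target.mem_nhds hy)).mdifferentiableAt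
      (by simp)
  have h2 : MDifferentiableAt (𝓡 n) (𝓡 n) φ (ψ.symm y) :=
    ((contMDiffOn_of_mem_maximalAtlas hφ).contMDiffAt (φ.open_source.mem_nhds hy')).mdifferentiableAt
      (by simp)
  have h3 : MDifferentiableAt (𝓡 n) (𝓡 n) φ.symm (φ (ψ.symm y)) :=
    ((contMDiffOn_symm_of_mem_maximalAtlas hφ).contMDiffAt
      (φ.open_target.mem_nhds (φ.map_source hy'))).mdifferentiableAt (by simp)
  have h4 : MDifferentiableAt (𝓡 n) (𝓡 n) (fun z => φ (ψ.symm z)) y := h2.comp y h1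
  refine ⟨(mdifferentiableAt_iff_differentiableAt.1 h4).hasFDerivAt, fun v => ?_⟩
  have h5 : ψ.symm =ᶠ[𝓝 y] φ.symm ∘ (fun z => φ (ψ.symm z)) := by
    have : ψ.target ∩ ψ.symm ⁻¹' φ.source ∈ 𝓝 y :=
      (ψ.symm.isOpen_inter_preimage φ.open_source).mem_nhds ⟨hy, hy'⟩
    filter_upwards [this] with z hz
    exact (φ.left_inv hz.2).symm
  have h6 := h5.mfderiv_eq (I := 𝓡 n) (I' := 𝓡 n)
  have h7 := mfderiv_comp y h3 h4
  rw [mfderiv_eq_fderiv] at h7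
  have h8 : (show Euc n →L[ℝ] Euc n from mfderiv (𝓡 n) (𝓡 n) ψ.symm y) =
    (show Euc n →L[ℝ] Euc n from mfderiv (𝓡 n) (𝓡 n) φ.symm (φ (ψ.symm y))).comp
      (fderiv ℝ (fun z => φ (ψ.symm z)) y) := h6.trans h7
  exact congrArg (fun L : Euc n →L[ℝ] Euc n => L v) h8

theorem volDensity_transition
    (g : ∀ x : M, TangentSpace (𝓡 n) x →ₗ[ℝ] TangentSpace (𝓡 n) x →ₗ[ℝ] ℝ)
    {φ ψ : OpenPartialHomeomorph M (Euc n)}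
    (hφ : φ ∈ IsManifold.maximalAtlas (𝓡 n) ∞ M) (hψ : ψ ∈ IsManifold.maximalAtlas (𝓡 n) ∞ M)
    {y : Euc n} (hy : y ∈ ψ.target) (hy' : ψ.symm y ∈ φ.source) :
    volDensity g ψ y = |(fderiv ℝ (fun z => φ (ψ.symm z)) y).det| *
      volDensity g φ (φ (ψ.symm y)) := by
  set J := fderiv ℝ (fun z => φ (ψ.symm z)) y with hJ
  let b := (EuclideanSpace.basisFun (Fin n) ℝ).toBasis
  let A := LinearMap.toMatrix b b J.toLinearMap
  have hdet : J.det = A.det := by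
    rw [LinearMap.det_toMatrix]
  let gE : M → Euc n →ₗ[ℝ] Euc n →ₗ[ℝ] ℝ := g
  let G : Matrix (Fin n) (Fin n) ℝ := Matrix.of fun k l : Fin n =>
    gE (φ.symm (φ (ψ.symm y))) (coordVec φ (φ (ψ.symm y)) k) (coordVec φ (φ (ψ.symm y)) l)
  have hJb : ∀ k, J (stdVec k) = ∑ p, A p k • (stdVec p : Euc n) := by
    intro k
    have := b.sum_repr (J (stdVec k))
    rw [← this]
    refine Finset.sum_congr rfl fun p _ => ?_
    simp [A, b, LinearMap.toMatrix_apply, stdVec]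
  have hc : ∀ k, (coordVec ψ y k : Euc n) = ∑ p, A p k • (coordVec φ (φ (ψ.symm y)) p : Euc n) := by
    intro k
    have h := (transition_hasFDerivAt hφ hψ hy hy').2 (stdVec k)
    refine h.trans ?_
    change (show Euc n →L[ℝ] Euc n from mfderiv (𝓡 n) (𝓡 n) φ.symm (φ (ψ.symm y))) (J (stdVec k)) = _
    rw [hJb, map_sum]
    refine Finset.sum_congr rfl fun p _ => ?_
    rw [map_smul]; rfl
  have hG : (Matrix.of fun k l : Fin n => gE (ψ.symm y) (coordVec ψ y k) (coordVec ψ y l))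
      = A.transpose * G * A := by
    ext k l
    simp only [Matrix.of_apply]
    rw [hc k, hc l]
    have hx : φ.symm (φ (ψ.symm y)) = ψ.symm y := φ.left_inv hy'
    have key : ∀ (F : Euc n →ₗ[ℝ] Euc n →ₗ[ℝ] ℝ) (u : Fin n → Euc n),
        F (∑ p, A p k • u p) (∑ q, A q l • u q) = ∑ q, (∑ p, A p k * F (u p) (u q)) * A q l := by
      intro F u
      simp only [map_sum, map_smul, smul_eq_mul, LinearMap.sum_apply, LinearMap.smul_apply, Finset.mul_sum,
        Finset.sum_mul]
      refine Finset.sum_congr rfl fun p _ => Finset.sum_congr rfl fun q _ => ?_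
      ring
    refine (key _ _).trans ?_
    simp only [Matrix.mul_apply, Matrix.transpose_apply, G, Matrix.of_apply, hx]
  have h1 : volDensity g ψ y = Real.sqrt (A.transpose * G * A).det := by
    rw [← hG]; rfl
  have h2 : volDensity g φ (φ (ψ.symm y)) = Real.sqrt G.det := rfl
  rw [h1, h2, hdet, Matrix.det_mul, Matrix.det_mul, Matrix.det_transpose,
    show A.det * G.det * A.det = A.det ^ 2 * G.det by ring, Real.sqrt_mul (sq_nonneg _),
    Real.sqrt_sq_eq_abs]

theorem exists_volume [IsManifold (𝓡 n) ∞ M] [SecondCountableTopology M] [MeasurableSpace M] [BorelSpace M]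
    (g : ∀ x : M, TangentSpace (𝓡 n) x →ₗ[ℝ] TangentSpace (𝓡 n) x →ₗ[ℝ] ℝ) :
    ∃ m : Measure M, ∀ φ ∈ IsManifold.maximalAtlas (𝓡 n) ∞ M, ∀ B ⊆ φ.source,
      MeasurableSet B →
        m B = ∫⁻ y in φ.target ∩ φ.symm ⁻¹' B, ENNReal.ofReal (volDensity g φ y) := by
  obtain ⟨s, hs, hU⟩ := TopologicalSpace.countable_cover_nhds
    (fun x : M => chart_source_mem_nhds (Euc n) x)
  have := hs.to_subtype
  rcases isEmpty_or_nonempty M with hM | hM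
  · refine ⟨0, fun φ _ B hB _ => ?_⟩
    have : φ.target ∩ φ.symm ⁻¹' B = ∅ := by
      ext z; simp; intro _ h; exact (hM.false (φ.symm z)).elim
    simp [this]
  have hne : s.Nonempty := by
    by_contra h
    rw [Set.not_nonempty_iff_eq_empty] at h
    obtain ⟨x⟩ := hM
    have : x ∈ ⋃ x ∈ s, (chartAt (Euc n) x).source := by rw [hU]; trivial
    simp [h] at this
  obtain ⟨f, hf⟩ := hs.exists_eq_range hne
  let c : ℕ → OpenPartialHomeomorph M (Euc n) := fun k => chartAt (Euc n) (f k)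
  have hc : ∀ k, c k ∈ IsManifold.maximalAtlas (𝓡 n) ∞ M := fun k =>
    IsManifold.chart_mem_maximalAtlas (f k)
  have hcov : ⋃ k, (c k).source = univ := by
    rw [← hU, hf]; simp [c]
  let D : ℕ → Set M := disjointed fun k => (c k).source
  have hDm : ∀ k, MeasurableSet (D k) := fun k =>
    MeasurableSet.disjointed (fun k => (c k).open_source.measurableSet) k
  have hDd : Pairwise (Function.onFun Disjoint D) := disjoint_disjointed _
  have hDU : ⋃ k, D k = univ := by rw [← hcov]; exact iUnion_disjointed
  have hDs : ∀ k, D k ⊆ (c k).source := fun k => disjointed_subset _ k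
  let m : ℕ → Measure M := fun k =>
    (((volume.restrict ((c k).target ∩ (c k).symm ⁻¹' D k)).withDensity
      fun y => ENNReal.ofReal (volDensity g (c k) y)).map (c k).symm)
  have hm : ∀ k, ∀ B, MeasurableSet B → m k B =
      ∫⁻ y in (c k).target ∩ (c k).symm ⁻¹' (B ∩ D k), ENNReal.ofReal (volDensity g (c k) y) := by
    intro k B hB
    have hae : AEMeasurable (c k).symm ((volume.restrict ((c k).target ∩ (c k).symm ⁻¹' D k)).withDensity
      fun y => ENNReal.ofReal (volDensity g (c k) y)) := by
      refine AEMeasurable.mono_ac ?_ (withDensity_absolutelyContinuous _ _)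
      exact (ContinuousOn.aemeasurable (c k).continuousOn_symm
        (c k).open_target.measurableSet).mono_set inter_subset_left
    rw [Measure.map_apply_of_aemeasurable hae hB, withDensity_apply',
      Measure.restrict_restrict' (measurableSet_image_chart _ (hDm k))]
    congr 2
    ext z; simp; tauto
  refine ⟨Measure.sum m, fun φ hφ B hBs hB => ?_⟩
  have hk : ∀ k, m k B = ∫⁻ y in φ.target ∩ φ.symm ⁻¹' (B ∩ D k),
      ENNReal.ofReal (volDensity g φ y) := by
    intro k
    rw [hm k B hB]
    have hBD := hB.inter (hDm k)
    set A := φ.target ∩ φ.symm ⁻¹' (B ∩ D k) with hA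
    have hAm : MeasurableSet A := measurableSet_image_chart φ hBD
    have himg : (c k).target ∩ (c k).symm ⁻¹' (B ∩ D k) = (fun z => (c k) (φ.symm z)) '' A := by
      ext z
      constructor
      · rintro ⟨hz, hz2⟩
        refine ⟨φ ((c k).symm z), ⟨φ.map_source (hBs hz2.1), ?_⟩, ?_⟩
        · simpa [φ.left_inv (hBs hz2.1)] using hz2
        · simp only [φ.left_inv (hBs hz2.1), (c k).right_inv hz]
      · rintro ⟨w, ⟨hw, hw2⟩, rfl⟩
        have hx : φ.symm w ∈ (c k).source := hDs k hw2.2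
        refine ⟨(c k).map_source hx, ?_⟩
        simpa [(c k).left_inv hx] using hw2
    have hsrc : ∀ z ∈ A, φ.symm z ∈ (c k).source := fun z hz => hDs k hz.2.2
    rw [himg, lintegral_image_eq_lintegral_abs_det_fderiv_mul volume hAm
      (fun z hz => (transition_hasFDerivAt (hc k) hφ hz.1 (hsrc z hz)).1.hasFDerivWithinAt)]
    · refine setLIntegral_congr_fun hAm fun z hz => ?_
      rw [volDensity_transition g (hc k) hφ hz.1 (hsrc z hz), ENNReal.ofReal_mul (abs_nonneg _)]
    · intro z hz w hw hzw
      have := (c k).injOn (hsrc z hz) (hsrc w hw) hzw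
      exact φ.symm.injOn hz.1 hw.1 this
  rw [Measure.sum_apply _ hB]
  simp_rw [hk]
  rw [← lintegral_iUnion]
  · congr 2
    rw [← inter_iUnion, ← preimage_iUnion, ← inter_iUnion, hDU, inter_univ]
  · exact fun k => measurableSet_image_chart φ (hB.inter (hDm k))
  · intro k l hkl
    have := hDd hkl
    rw [Function.onFun, Set.disjoint_left] at this ⊢
    intro z hz hz'
    exact this hz.2.2 hz'.2.2
/-- The volume measure of a field `g` of bilinear forms on the tangent spaces: the Borel measure
that is `√ det (g_{μν}) dx¹ ⋯ dxⁿ` in every chart. -/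
def volumeMeasure [IsManifold (𝓡 n) ∞ M] [SecondCountableTopology M] [MeasurableSpace M]
    [BorelSpace M] (g : ∀ x : M, TangentSpace (𝓡 n) x →ₗ[ℝ] TangentSpace (𝓡 n) x →ₗ[ℝ] ℝ) :
    Measure M :=
  (exists_volume g).choose

theorem volumeMeasure_apply [IsManifold (𝓡 n) ∞ M] [SecondCountableTopology M]
    [MeasurableSpace M] [BorelSpace M]
    (g : ∀ x : M, TangentSpace (𝓡 n) x →ₗ[ℝ] TangentSpace (𝓡 n) x →ₗ[ℝ] ℝ)
    {φ : OpenPartialHomeomorph M (Euc n)} (hφ : φ ∈ IsManifold.maximalAtlas (𝓡 n) ∞ M)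
    {B : Set M} (hBs : B ⊆ φ.source) (hB : MeasurableSet B) :
    volumeMeasure g B = ∫⁻ y in chartRegion φ B, ENNReal.ofReal (volDensity g φ y) :=
  (exists_volume g).choose_spec φ hφ B hBs hB

end Volume

/-! ### Spin structures, singular metrics, Levi-Civita connections, spinor fields -/

/-- Components `τ_μ^a` of an `ℝⁿ`-valued 1-form in the chart `φ`, as functions of the
coordinates. -/
def coframeComp {n : ℕ} {M : Type*} [TopologicalSpace M] [ChartedSpace (Euc n) M]
    (t : ∀ x : M, TangentSpace (𝓡 n) x →L[ℝ] Euc n) (φ : OpenPartialHomeomorph M (Euc n))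
    (m a : Fin n) (y : Euc n) : ℝ :=
  t (φ.symm y) (coordVec φ y m) a

/-- A spin structure on the manifold `M`, presented by local trivializations: a smooth principal
`Spin(n)`-bundle given by transition functions `g_{ij}` on an open cover, together with a smooth
soldering form, i.e. smooth local coframes related by the image of `g_{ij}` in `SO(n)`. The latter
identifies the associated `SO(n)`-bundle with a reduction of the frame bundle of `M`. A function
into the Clifford algebra is smooth if its composition with every linear functional is. -/
structure SpinStructure (n : ℕ) (M : Type*) [TopologicalSpace M] [ChartedSpace (Euc n) M]
    (I : Type*) where
  /-- The domains of the local trivializations. -/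
  dom : I → Set M
  isOpen_dom : ∀ i, IsOpen (dom i)
  cover : ∀ x, ∃ i, x ∈ dom i
  /-- The transition functions. -/
  trans : I → I → M → Cl n
  trans_mem : ∀ i j, ∀ x ∈ dom i ∩ dom j, trans i j x ∈ spinGroup (euclidQ n)
  trans_self : ∀ i, ∀ x ∈ dom i, trans i i x = 1
  trans_comp : ∀ i j k, ∀ x ∈ dom i ∩ dom j ∩ dom k,
    trans i j x * trans j k x = trans i k x
  trans_smooth : ∀ i j (L : Cl n →ₗ[ℝ] ℝ),
    ContMDiffOn (𝓡 n) 𝓘(ℝ, ℝ) ∞ (fun x => L (trans i j x)) (dom i ∩ dom j)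
  /-- The smooth reference coframes. -/
  refCoframe : I → ∀ x : M, TangentSpace (𝓡 n) x →L[ℝ] Euc n
  refCoframe_bijective : ∀ i, ∀ x ∈ dom i, Function.Bijective (refCoframe i x)
  refCoframe_smooth : ∀ i, ∀ φ ∈ IsManifold.maximalAtlas (𝓡 n) ∞ M, ∀ m a,
    ContDiffOn ℝ ∞ (coframeComp (refCoframe i) φ m a) (chartRegion φ (dom i))
  refCoframe_trans : ∀ i j, ∀ x ∈ dom i ∩ dom j, ∀ v : TangentSpace (𝓡 n) x,
    clVec (refCoframe i x v) * trans i j x = trans i j x * clVec (refCoframe j x v)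

section Spin

variable {n : ℕ} {M : Type*} [TopologicalSpace M] [ChartedSpace (Euc n) M] {I : Type*}

/-- A possibly singular Riemannian metric on a spin manifold, given by an `ℝⁿ`-valued soldering form
on the principal bundle, i.e. by local coframes `τ_i` related by the transition functions. Outside
of a closed set of measure zero the coordinate components are locally integrable and have
distributional first partial derivatives that are functions. The coframes are invertible almost
everywhere. -/
structure SingularMetric (P : SpinStructure n M I) where
  /-- The coframe in each local trivialization. -/
  cof : I → ∀ x : M, TangentSpace (𝓡 n) x →L[ℝ] Euc n
  cof_trans : ∀ i j, ∀ x ∈ P.dom i ∩ P.dom j, ∀ v : TangentSpace (𝓡 n) x,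
    clVec (cof i x v) * P.trans i j x = P.trans i j x * clVec (cof j x v)
  /-- The singular set. -/
  sing : Set M
  isClosed_sing : IsClosed sing
  sing_null : ∀ φ ∈ IsManifold.maximalAtlas (𝓡 n) ∞ M, volume (chartRegion φ sing) = 0
  bijective : ∀ i, ∀ φ ∈ IsManifold.maximalAtlas (𝓡 n) ∞ M,
    ∀ᵐ y ∂volume.restrict (chartRegion φ (P.dom i)), Function.Bijective (cof i (φ.symm y))
  weakDiff : ∀ i, ∀ φ ∈ IsManifold.maximalAtlas (𝓡 n) ∞ M, ∀ m k a, ∃ h : Euc n → ℝ,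
    IsWeakPartial (chartRegion φ (P.dom i \ sing)) m (coframeComp (cof i) φ k a) h

/-- The metric tensor: the pullback of the Euclidean inner product by the coframe of any local
trivialization around the point. -/
def SingularMetric.metric {P : SpinStructure n M I} (e : SingularMetric P) (x : M) :
    TangentSpace (𝓡 n) x →ₗ[ℝ] TangentSpace (𝓡 n) x →ₗ[ℝ] ℝ :=
  (innerₗ (Euc n)).compl₁₂ (e.cof (P.cover x).choose x).toLinearMap
    (e.cof (P.cover x).choose x).toLinearMap

/-- The Riemannian volume measure `dvol_g`. -/
def SingularMetric.dvol {P : SpinStructure n M I} (e : SingularMetric P)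
    [IsManifold (𝓡 n) ∞ M] [SecondCountableTopology M] [MeasurableSpace M] [BorelSpace M] :
    Measure M :=
  volumeMeasure e.metric

/-- The metric tensor does not depend on the local trivialization. -/
theorem SingularMetric.metric_apply {P : SpinStructure n M I} (e : SingularMetric P) {i : I} {x : M}
    (hx : x ∈ P.dom i) (v w : TangentSpace (𝓡 n) x) :
    e.metric x v w = inner ℝ (e.cof i x v) (e.cof i x w) := by
  have hn : ∀ u : TangentSpace (𝓡 n) x,
      ‖e.cof (P.cover x).choose x u‖ = ‖e.cof i x u‖ := by
    intro u
    have hj := (P.cover x).choose_spec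
    have h := e.cof_trans _ _ x ⟨hj, hx⟩ u
    have hg := P.trans_mem _ _ x ⟨hj, hx⟩
    set g := P.trans (P.cover x).choose i x
    set a := e.cof (P.cover x).choose x u
    set b := e.cof i x u
    have h2 : algebraMap ℝ (Cl n) (euclidQ n a) * g = algebraMap ℝ (Cl n) (euclidQ n b) * g := by
      rw [← CliffordAlgebra.ι_sq_scalar, mul_assoc, h, ← mul_assoc, h, mul_assoc,
        CliffordAlgebra.ι_sq_scalar, Algebra.commutes]
    have h3 : algebraMap ℝ (Cl n) (euclidQ n a) = algebraMap ℝ (Cl n) (euclidQ n b) := by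
      have h4 := congrArg (fun z => z * star g) h2
      simpa only [mul_assoc, spinGroup.mul_star_self_of_mem hg, mul_one] using h4
    have h5 := (algebraMap ℝ (Cl n)).injective h3
    rw [euclidQ_apply, euclidQ_apply] at h5
    exact (sq_eq_sq₀ (norm_nonneg _) (norm_nonneg _)).1 h5
  change inner ℝ (e.cof (P.cover x).choose x v) (e.cof (P.cover x).choose x w) = _
  rw [real_inner_eq_norm_add_mul_self_sub_norm_mul_self_sub_norm_mul_self_div_two,
    real_inner_eq_norm_add_mul_self_sub_norm_mul_self_sub_norm_mul_self_div_two,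
    ← map_add, ← map_add, hn, hn, hn]

/-- The orthonormal frame `e_a` dual to the coframe in the local trivialization `i`. -/
def SingularMetric.frame {P : SpinStructure n M I} (e : SingularMetric P) (i : I) (a : Fin n)
    (x : M) : TangentSpace (𝓡 n) x :=
  (e.cof i x).inverse (stdVec a)

/-- The coordinate components `e_a^μ` of the orthonormal frame, in the chart `φ`. -/
def SingularMetric.frameComp {P : SpinStructure n M I} (e : SingularMetric P) (i : I)
    (φ : OpenPartialHomeomorph M (Euc n)) (a m : Fin n) (x : M) : ℝ :=
  coordComp φ (e.frame i a x) m

/-- The element `(1/8) ω_{jk} [γʲ, γᵏ]` of the Clifford algebra. -/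
def spinLift {n : ℕ} (w : Matrix (Fin n) (Fin n) ℝ) : Cl n :=
  (1 / 8 : ℝ) • ∑ j, ∑ k, w j k •
    (clVec (stdVec j) * clVec (stdVec k) - clVec (stdVec k) * clVec (stdVec j))

/-- The Levi-Civita connection of a singular metric: a measurable connection on the principal
`Spin(n)`-bundle, given by its local connection 1-forms `ω^a_b`, which is compatible with the metric
(`skew`) and torsion-free, `dτ^a + ω^a_b ∧ τ^b = 0`, off the singular set. The condition `gauge` says
that the local forms `(1/8) ω_{jk} [γʲ, γᵏ]` make up a connection on the principal bundle:
`A_i = g A_j g⁻¹ - (dg) g⁻¹` where `g = g_{ij}`. -/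
structure LeviCivita {P : SpinStructure n M I} (e : SingularMetric P)
    [IsManifold (𝓡 n) ∞ M] [SecondCountableTopology M] [MeasurableSpace M] [BorelSpace M] where
  /-- The connection 1-form in each local trivialization; the entry with indices `a b` of the matrix
  is `ω^a_b`. -/
  form : I → ∀ x : M, TangentSpace (𝓡 n) x →ₗ[ℝ] Matrix (Fin n) (Fin n) ℝ
  measurable : ∀ i, ∀ φ ∈ IsManifold.maximalAtlas (𝓡 n) ∞ M, ∀ m a b,
    AEMeasurable (fun y => form i (φ.symm y) (coordVec φ y m) a b)
      (volume.restrict (chartRegion φ (P.dom i)))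
  skew : ∀ i, ∀ x ∈ P.dom i, ∀ v : TangentSpace (𝓡 n) x, ∀ a b,
    form i x v a b = - form i x v b a
  torsionFree : ∀ i, ∀ φ ∈ IsManifold.maximalAtlas (𝓡 n) ∞ M, ∀ m k a, ∀ h h' : Euc n → ℝ,
    IsWeakPartial (chartRegion φ (P.dom i \ e.sing)) m (coframeComp (e.cof i) φ k a) h →
    IsWeakPartial (chartRegion φ (P.dom i \ e.sing)) k (coframeComp (e.cof i) φ m a) h' →
    ∀ᵐ y ∂volume.restrict (chartRegion φ (P.dom i \ e.sing)),
      h y - h' y =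
        - ∑ b, form i (φ.symm y) (coordVec φ y m) a b * coframeComp (e.cof i) φ k b y
        + ∑ b, form i (φ.symm y) (coordVec φ y k) a b * coframeComp (e.cof i) φ m b y
  gauge : ∀ i j, ∀ᵐ x ∂e.dvol, x ∈ P.dom i ∩ P.dom j →
    ∀ (v : TangentSpace (𝓡 n) x) (L : Cl n →ₗ[ℝ] ℝ),
      L (spinLift (form i x v) * P.trans i j x) = L (P.trans i j x * spinLift (form j x v))
        - (show ℝ from mfderiv (𝓡 n) 𝓘(ℝ, ℝ) (fun z => L (P.trans i j z)) x v)

/-- The components `ω_{abc} = ω^a_b (e_c)` of the connection in the local trivialization `i`. -/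
def LeviCivita.comp {P : SpinStructure n M I} {e : SingularMetric P}
    [IsManifold (𝓡 n) ∞ M] [SecondCountableTopology M] [MeasurableSpace M] [BorelSpace M]
    (w : LeviCivita e) (i : I) (a b c : Fin n) (x : M) : ℝ :=
  w.form i x (e.frame i c x) a b

variable {V : Type*} [NormedAddCommGroup V] [InnerProductSpace ℂ V]

/-- A smooth compactly supported spinor field: a smooth compactly supported section of the vector
bundle associated to the principal `Spin(n)`-bundle and the representation on `V`, given by its local
representatives. -/
structure SpinorField (P : SpinStructure n M I) (R : CliffordModule n V) where
  /-- The representative in each local trivialization. -/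
  val : I → M → V
  val_trans : ∀ i j, ∀ x ∈ P.dom i ∩ P.dom j, val i x = R.rep (P.trans i j x) (val j x)
  smooth : ∀ i, ContMDiffOn (𝓡 n) 𝓘(ℝ, V) ∞ (val i) (P.dom i)
  compact : ∃ K : Set M, IsCompact K ∧ ∀ i, ∀ x ∈ P.dom i, x ∉ K → val i x = 0

section Operators

variable {P : SpinStructure n M I} {e : SingularMetric P} {R : CliffordModule n V}
  [IsManifold (𝓡 n) ∞ M] [SecondCountableTopology M] [MeasurableSpace M] [BorelSpace M]

/-- The covariant derivative `∇_c ψ = ∂_{e_c} ψ + (1/8) ω_{jkc} [γʲ, γᵏ] ψ` in the local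
trivialization `i`. -/
def nabla (w : LeviCivita e) (f : SpinorField P R) (i : I) (c : Fin n) (x : M) : V :=
  (show V from mfderiv (𝓡 n) 𝓘(ℝ, V) (f.val i) x (e.frame i c x)) +
    (1 / 8 : ℝ) • ∑ j, ∑ k, w.comp i j k c x •
      (R.gam j * R.gam k - R.gam k * R.gam j) (f.val i x)

/-- The Dirac operator `D ψ = - √(-1) γᶜ ∇_c ψ` in the local trivialization `i`. -/
def dirac (w : LeviCivita e) (f : SpinorField P R) (i : I) (x : M) : V :=
  - Complex.I • ∑ c, R.gam c (nabla w f i c x)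

/-- The function `⟨D η, D ψ⟩ - ⟨∇ η, ∇ ψ⟩` in the local trivialization `i`. -/
def lichIntegrand (w : LeviCivita e) (f h : SpinorField P R) (i : I) (x : M) : ℂ :=
  inner ℂ (dirac w f i x) (dirac w h i x) - ∑ c, inner ℂ (nabla w f i c x) (nabla w h i c x)

/-- The integral `∫_M (⟨D η, D ψ⟩ - ⟨∇ η, ∇ ψ⟩) dvol_g` is well defined: the local expressions
of the integrand agree almost everywhere with a function on `M` that is integrable with respect to
`dvol_g`. -/
def LichWellDefined (w : LeviCivita e) (f h : SpinorField P R) : Prop :=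
  ∃ F : M → ℂ, Integrable F e.dvol ∧
    ∀ i, ∀ᵐ x ∂e.dvol, x ∈ P.dom i → F x = lichIntegrand w f h i x

end Operators

/-- The family of functions `T : (local frames) → (charts) → M → ℝ` is `L¹` with respect to `dvol_g`
in local coordinates: for every local trivialization of the spin structure and every chart, the
function is locally integrable on the intersection of their domains. -/
def LocallyL1 {P : SpinStructure n M I} (e : SingularMetric P)
    [IsManifold (𝓡 n) ∞ M] [SecondCountableTopology M] [MeasurableSpace M] [BorelSpace M]
    (T : I → OpenPartialHomeomorph M (Euc n) → M → ℝ) : Prop :=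
  ∀ i, ∀ φ ∈ IsManifold.maximalAtlas (𝓡 n) ∞ M,
    LocallyIntegrableOn (T i φ) (P.dom i ∩ φ.source) e.dvol

end Spin

end

noncomputable section

/-! ### Antisymmetrized products of Clifford matrices -/

/-! The integrand is an algebraic expression in the covariant derivatives. The Clifford matrices are
self-adjoint and γᶜγᵈ = γ^{[c}γ^{d]} + δᶜᵈ, so the difference of the two inner products is ∑ ⟨∇_c η,
γ^{[c}γ^{d]} ∇_d ψ⟩ (`CliffordModule.inner_dirac`). Inserting ∇_c = e_c^μ ∂_μ + ¼ ω_{jkc}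
γ^{[j}γ^{k]} gives, in a chart, a sesquilinear expression in the values and first partial
derivatives of η and ψ, with operator-valued coefficients of second, first and zeroth order
(`lichIntegrand_eq_chart`).

Integrability near a point for all η, ψ is equivalent to integrability of the matrix elements of
these coefficients. If the coefficients are integrable, they are only multiplied by continuous
functions. Conversely, spinors that are constant or linear in the coordinates near the point isolate
the coefficients one order at a time (`coeffIntegrable_of_forall`).

Each coefficient is then expanded as s + B_{ab} γ^{[a}γ^{b]} + Z_{abcd} γ^{[a}γ^bγ^cγ^{d]}. The
first-order one comes from multiplying two antisymmetrized pairs (`Gamma.Rel.sum_g2_mul_form2`). The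
zeroth-order one, quadratic in ω, has no two-form part, which is why it yields only two conditions
(`Gamma.Rel.sum_form2_mul_g2_mul_form2`). Multiplication by constant matrices preserves
integrability of matrix elements, and graded commutators with the γ's contract indices, so an
expansion is integrable exactly when all its antisymmetric coefficients are
(`Gamma.Rel.mem_iff_coeff_mem`).

Finally, the integrand is gauge invariant almost everywhere (`lichIntegrand_trans`). The local
expressions therefore glue to a function with compact support, for which local integrability is
integrability (`lichWellDefined_of_integrableAtFilter`). -/

/-- The Kronecker symbol, as a real number. -/
def kron {n : ℕ} (a b : Fin n) : ℝ := if a = b then 1 else 0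

theorem kron_comm {n : ℕ} (a b : Fin n) : kron a b = kron b a := by
  simp [kron, eq_comm]

theorem sum_kron_smul {n : ℕ} {A : Type*} [AddCommGroup A] [Module ℝ A] (a : Fin n)
    (f : Fin n → A) : ∑ b, kron a b • f b = f a := by
  simp [kron, ite_smul]

theorem sum_kron_mul {n : ℕ} (a : Fin n) (f : Fin n → ℝ) : ∑ b, kron a b * f b = f a := by
  simp [kron]

namespace Gamma

variable {n : ℕ} {A : Type*} [Ring A] [Algebra ℝ A]

/-- The Clifford relations `γʲ γᵏ + γᵏ γʲ = 2 δʲᵏ`. -/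
def Rel (γ : Fin n → A) : Prop := ∀ j k, γ j * γ k + γ k * γ j = (2 * kron j k) • (1 : A)

/-- The antisymmetrized product of two Clifford matrices. -/
def g2 (γ : Fin n → A) (a b : Fin n) : A := γ a * γ b - kron a b • (1 : A)

/-- The antisymmetrized product of three Clifford matrices. -/
def g3 (γ : Fin n → A) (a b c : Fin n) : A :=
  γ a * g2 γ b c - kron a b • γ c + kron a c • γ b

/-- The antisymmetrized product of four Clifford matrices. -/
def g4 (γ : Fin n → A) (a b c d : Fin n) : A :=
  γ a * g3 γ b c d - kron a b • g2 γ c d + kron a c • g2 γ b d - kron a d • g2 γ b c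

variable {γ : Fin n → A}

theorem Rel.mul_swap (h : Rel γ) (a b : Fin n) :
    γ a * γ b = (2 * kron a b) • (1 : A) - γ b * γ a :=
  eq_sub_of_add_eq (h a b)

theorem Rel.mul_swap_assoc (h : Rel γ) (a b : Fin n) (x : A) :
    γ a * (γ b * x) = (2 * kron a b) • x - γ b * (γ a * x) := by
  rw [← mul_assoc, h.mul_swap, sub_mul, smul_mul_assoc, one_mul, mul_assoc]

theorem Rel.g2_swap (h : Rel γ) (a b : Fin n) : g2 γ a b = - g2 γ b a := by
  simp only [g2, h.mul_swap a b, kron_comm b a]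
  module

/-- The recursive definition makes antisymmetry in the tail inherited from lower degree. Only the
swap of the first two indices uses the Clifford relation anew. The same pattern holds in degree
four, and adjacent swaps give total antisymmetry. -/
theorem Rel.g3_swap_right (h : Rel γ) (a b c : Fin n) : g3 γ a b c = - g3 γ a c b := by
  simp only [g3, h.g2_swap b c, mul_neg]
  module

theorem Rel.g3_swap_left (h : Rel γ) (a b c : Fin n) : g3 γ a b c = - g3 γ b a c := by
  simp only [g3, g2, mul_sub, mul_smul_comm, mul_one, h.mul_swap_assoc a b, kron_comm b a]
  module

theorem Rel.g4_swap_right (h : Rel γ) (a b c d : Fin n) : g4 γ a b c d = - g4 γ a b d c := by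
  simp only [g4, h.g3_swap_right b c d, h.g2_swap c d, mul_neg]
  module

theorem Rel.g4_swap_mid (h : Rel γ) (a b c d : Fin n) : g4 γ a b c d = - g4 γ a c b d := by
  simp only [g4, h.g3_swap_left b c d, h.g2_swap b c, mul_neg]
  module

theorem Rel.g4_swap_left (h : Rel γ) (a b c d : Fin n) : g4 γ a b c d = - g4 γ b a c d := by
  simp only [g4, g3, mul_sub, mul_add, mul_smul_comm, mul_one, h.mul_swap_assoc a b, h.mul_swap a b,
    kron_comm b a, g2]
  module

/-- Moving a Clifford matrix past an antisymmetrized product of degree p costs the sign (-1)^p and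
leaves twice the alternating sum of contractions. Hence commutators in even degree and
anticommutators in odd degree lower the degree by one. -/
theorem Rel.commutator_g2 (h : Rel γ) (a b c : Fin n) :
    γ a * g2 γ b c - g2 γ b c * γ a = (2 : ℝ) • (kron a b • γ c - kron a c • γ b) := by
  simp only [g2, mul_sub, sub_mul, mul_smul_comm, smul_mul_assoc, mul_one, one_mul,
    h.mul_swap_assoc a b, mul_assoc, h.mul_swap a c]
  module

theorem Rel.anticommutator_g3 (h : Rel γ) (a b c d : Fin n) :
    γ a * g3 γ b c d + g3 γ b c d * γ a =
      (2 : ℝ) • (kron a b • g2 γ c d - kron a c • g2 γ b d + kron a d • g2 γ b c) := by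
  have h2 := eq_add_of_sub_eq (h.commutator_g2 a c d)
  simp only [g3, mul_sub, mul_add, sub_mul, add_mul, mul_smul_comm, smul_mul_assoc,
    h.mul_swap_assoc a b, mul_assoc, h.mul_swap a c, h.mul_swap a d, h2]
  simp only [g2, smul_sub]
  module

theorem Rel.commutator_g4 (h : Rel γ) (a b c d e : Fin n) :
    γ a * g4 γ b c d e - g4 γ b c d e * γ a =
      (2 : ℝ) • (kron a b • g3 γ c d e - kron a c • g3 γ b d e + kron a d • g3 γ b c e
        - kron a e • g3 γ b c d) := by
  have h3 := eq_sub_of_add_eq (h.anticommutator_g3 a c d e)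
  have h2 := fun x y => eq_add_of_sub_eq (h.commutator_g2 a x y)
  simp only [g4, mul_sub, mul_add, sub_mul, add_mul, mul_smul_comm, smul_mul_assoc,
    h.mul_swap_assoc a b, mul_assoc, h3, h2]
  simp only [g3]
  module

theorem mul_eq_g2 (a b : Fin n) : γ a * γ b = g2 γ a b + kron a b • (1 : A) := by
  simp [g2]

theorem mul_g2 (a b c : Fin n) :
    γ a * g2 γ b c = g3 γ a b c + kron a b • γ c - kron a c • γ b := by
  simp only [g3]; module

theorem mul_g3 (a b c d : Fin n) : γ a * g3 γ b c d =
    g4 γ a b c d + kron a b • g2 γ c d - kron a c • g2 γ b d + kron a d • g2 γ b c := by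
  simp only [g4]; module

/-- The terms are those with no, one or two contractions between the two pairs; applying the
one-vector rules `mul_g2` and `mul_g3` to γ_c (γ_d γ^{[j}γ^{k]}) produces them. -/
theorem g2_mul_g2 (c d j k : Fin n) : g2 γ c d * g2 γ j k = g4 γ c d j k
    + kron d j • g2 γ c k - kron d k • g2 γ c j - kron c j • g2 γ d k + kron c k • g2 γ d j
    + (kron d j * kron c k - kron c j * kron d k) • (1 : A) := by
  rw [show g2 γ c d * g2 γ j k = γ c * (γ d * g2 γ j k) - kron c d • g2 γ j k by
    simp only [g2, sub_mul, mul_assoc, smul_mul_assoc, one_mul]]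
  simp only [mul_g2, mul_sub, mul_add, mul_smul_comm, mul_g3, mul_eq_g2]
  module

/-! ### Contraction of antisymmetric tensors -/

/-- Antisymmetry of the coefficients makes all p contractions equal, so the factor is 2p: 4 here,
then 6 and 8 in degrees three and four. -/
theorem Rel.commutator_sum_g2 (h : Rel γ) {Z : Fin n → Fin n → ℝ}
    (hZ : ∀ b c, Z b c = - Z c b) (a : Fin n) :
    γ a * (∑ b, ∑ c, Z b c • g2 γ b c) - (∑ b, ∑ c, Z b c • g2 γ b c) * γ a =
      (4 : ℝ) • ∑ c, Z a c • γ c := by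
  have e : γ a * (∑ b, ∑ c, Z b c • g2 γ b c) - (∑ b, ∑ c, Z b c • g2 γ b c) * γ a =
      (2 : ℝ) • ((∑ b, ∑ c, kron a b • Z b c • γ c) - ∑ b, ∑ c, kron a c • Z b c • γ b) := by
    simp only [Finset.mul_sum, Finset.sum_mul, mul_smul_comm, smul_mul_assoc,
      ← Finset.sum_sub_distrib, Finset.smul_sum, ← smul_sub, h.commutator_g2]
    refine Finset.sum_congr rfl fun b _ => Finset.sum_congr rfl fun c _ => ?_
    module
  rw [e]
  simp only [← Finset.smul_sum, sum_kron_smul, hZ _ a, neg_smul, Finset.sum_neg_distrib]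
  module

theorem Rel.anticommutator_sum_g3 (h : Rel γ) {Z : Fin n → Fin n → Fin n → ℝ}
    (hl : ∀ b c d, Z b c d = - Z c b d) (hr : ∀ b c d, Z b c d = - Z b d c) (a : Fin n) :
    γ a * (∑ b, ∑ c, ∑ d, Z b c d • g3 γ b c d) + (∑ b, ∑ c, ∑ d, Z b c d • g3 γ b c d) * γ a =
      (6 : ℝ) • ∑ c, ∑ d, Z a c d • g2 γ c d := by
  have e : γ a * (∑ b, ∑ c, ∑ d, Z b c d • g3 γ b c d)
        + (∑ b, ∑ c, ∑ d, Z b c d • g3 γ b c d) * γ a =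
      (2 : ℝ) • ((∑ b, ∑ c, ∑ d, kron a b • Z b c d • g2 γ c d)
        - (∑ b, ∑ c, ∑ d, kron a c • Z b c d • g2 γ b d)
        + ∑ b, ∑ c, ∑ d, kron a d • Z b c d • g2 γ b c) := by
    simp only [Finset.mul_sum, Finset.sum_mul, mul_smul_comm, smul_mul_assoc,
      ← Finset.sum_sub_distrib, ← Finset.sum_add_distrib, Finset.smul_sum, ← smul_add,
      h.anticommutator_g3]
    refine Finset.sum_congr rfl fun b _ => Finset.sum_congr rfl fun c _ =>
      Finset.sum_congr rfl fun d _ => ?_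
    module
  rw [e]
  have e1 : ∀ b d, Z b a d = - Z a b d := fun b d => hl b a d
  have e2 : ∀ b c, Z b c a = Z a b c := fun b c => by rw [hr, hl, neg_neg]
  simp only [← Finset.smul_sum, sum_kron_smul, e1, e2, neg_smul, Finset.sum_neg_distrib]
  module

theorem Rel.commutator_sum_g4 (h : Rel γ) {Z : Fin n → Fin n → Fin n → Fin n → ℝ}
    (hl : ∀ b c d e, Z b c d e = - Z c b d e) (hm : ∀ b c d e, Z b c d e = - Z b d c e)
    (hr : ∀ b c d e, Z b c d e = - Z b c e d) (a : Fin n) :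
    γ a * (∑ b, ∑ c, ∑ d, ∑ e, Z b c d e • g4 γ b c d e)
        - (∑ b, ∑ c, ∑ d, ∑ e, Z b c d e • g4 γ b c d e) * γ a =
      (8 : ℝ) • ∑ c, ∑ d, ∑ e, Z a c d e • g3 γ c d e := by
  have e : γ a * (∑ b, ∑ c, ∑ d, ∑ e, Z b c d e • g4 γ b c d e)
        - (∑ b, ∑ c, ∑ d, ∑ e, Z b c d e • g4 γ b c d e) * γ a =
      (2 : ℝ) • ((∑ b, ∑ c, ∑ d, ∑ e, kron a b • Z b c d e • g3 γ c d e)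
        - (∑ b, ∑ c, ∑ d, ∑ e, kron a c • Z b c d e • g3 γ b d e)
        + (∑ b, ∑ c, ∑ d, ∑ e, kron a d • Z b c d e • g3 γ b c e)
        - ∑ b, ∑ c, ∑ d, ∑ e, kron a e • Z b c d e • g3 γ b c d) := by
    simp only [Finset.mul_sum, Finset.sum_mul, mul_smul_comm, smul_mul_assoc,
      ← Finset.sum_sub_distrib, ← Finset.sum_add_distrib, Finset.smul_sum, ← smul_sub,
      h.commutator_g4]
    refine Finset.sum_congr rfl fun b _ => Finset.sum_congr rfl fun c _ =>
      Finset.sum_congr rfl fun d _ => Finset.sum_congr rfl fun e _ => ?_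
    module
  rw [e]
  have e1 : ∀ b d e, Z b a d e = - Z a b d e := fun b d e => hl b a d e
  have e2 : ∀ b c e, Z b c a e = Z a b c e := fun b c e => by rw [hm, hl, neg_neg]
  have e3 : ∀ b c d, Z b c d a = - Z a b c d := fun b c d => by rw [hr, hm, hl, neg_neg]
  simp only [← Finset.smul_sum, sum_kron_smul, e1, e2, e3, neg_smul, Finset.sum_neg_distrib]
  module

/-! ### Sums of antisymmetrized products with tensor coefficients -/

/-- The element `X_{ab} γ^{[a} γ^{b]}`. -/
def form2 (γ : Fin n → A) (X : Fin n → Fin n → ℝ) : A := ∑ a, ∑ b, X a b • g2 γ a b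

/-- The element `X_{abc} γ^{[a} γ^b γ^{c]}`. -/
def form3 (γ : Fin n → A) (X : Fin n → Fin n → Fin n → ℝ) : A :=
  ∑ a, ∑ b, ∑ c, X a b c • g3 γ a b c

/-- The element `X_{abcd} γ^{[a} γ^b γ^c γ^{d]}`. -/
def form4 (γ : Fin n → A) (X : Fin n → Fin n → Fin n → Fin n → ℝ) : A :=
  ∑ a, ∑ b, ∑ c, ∑ d, X a b c d • g4 γ a b c d

theorem form4_add (X Y : Fin n → Fin n → Fin n → Fin n → ℝ) :
    form4 γ (fun a b c d => X a b c d + Y a b c d) = form4 γ X + form4 γ Y := by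
  simp only [form4, add_smul, Finset.sum_add_distrib]

theorem form4_sub (X Y : Fin n → Fin n → Fin n → Fin n → ℝ) :
    form4 γ (fun a b c d => X a b c d - Y a b c d) = form4 γ X - form4 γ Y := by
  simp only [form4, sub_smul, Finset.sum_sub_distrib]

theorem form4_smul (r : ℝ) (X : Fin n → Fin n → Fin n → Fin n → ℝ) :
    form4 γ (fun a b c d => r * X a b c d) = r • form4 γ X := by
  simp only [form4, mul_smul, ← Finset.smul_sum]

theorem form4_neg (X : Fin n → Fin n → Fin n → Fin n → ℝ) :
    form4 γ (fun a b c d => - X a b c d) = - form4 γ X := by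
  simp only [form4, neg_smul, Finset.sum_neg_distrib]

theorem form4_sum (X : Fin n → Fin n → Fin n → Fin n → Fin n → ℝ) :
    form4 γ (fun a b c d => ∑ r, X r a b c d) = ∑ r, form4 γ (X r) := by
  simp only [form4, Finset.sum_smul]
  symm
  rw [Finset.sum_comm]
  refine Finset.sum_congr rfl fun a _ => ?_
  rw [Finset.sum_comm]
  refine Finset.sum_congr rfl fun b _ => ?_
  rw [Finset.sum_comm]
  refine Finset.sum_congr rfl fun c _ => ?_
  rw [Finset.sum_comm]

theorem Rel.form4_swap_left (h : Rel γ) (X : Fin n → Fin n → Fin n → Fin n → ℝ) :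
    form4 γ (fun a b c d => X b a c d) = - form4 γ X := by
  rw [form4, Finset.sum_comm]
  simp only [form4, ← Finset.sum_neg_distrib, ← smul_neg]
  refine Finset.sum_congr rfl fun a _ => Finset.sum_congr rfl fun b _ =>
    Finset.sum_congr rfl fun c _ => Finset.sum_congr rfl fun d _ => ?_
  rw [h.g4_swap_left]

theorem Rel.form4_swap_mid (h : Rel γ) (X : Fin n → Fin n → Fin n → Fin n → ℝ) :
    form4 γ (fun a b c d => X a c b d) = - form4 γ X := by
  simp only [form4, ← Finset.sum_neg_distrib, ← smul_neg]
  refine Finset.sum_congr rfl fun a _ => ?_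
  rw [Finset.sum_comm]
  refine Finset.sum_congr rfl fun b _ =>
    Finset.sum_congr rfl fun c _ => Finset.sum_congr rfl fun d _ => ?_
  rw [h.g4_swap_mid]

theorem Rel.form4_swap_right (h : Rel γ) (X : Fin n → Fin n → Fin n → Fin n → ℝ) :
    form4 γ (fun a b c d => X a b d c) = - form4 γ X := by
  simp only [form4, ← Finset.sum_neg_distrib, ← smul_neg]
  refine Finset.sum_congr rfl fun a _ => Finset.sum_congr rfl fun b _ => ?_
  rw [Finset.sum_comm]
  refine Finset.sum_congr rfl fun c _ => Finset.sum_congr rfl fun d _ => ?_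
  rw [h.g4_swap_right]

theorem Rel.form2_swap (h : Rel γ) (X : Fin n → Fin n → ℝ) :
    form2 γ (fun a b => X b a) = - form2 γ X := by
  rw [form2, Finset.sum_comm]
  simp only [form2, ← Finset.sum_neg_distrib, ← smul_neg]
  refine Finset.sum_congr rfl fun a _ => Finset.sum_congr rfl fun b _ => ?_
  rw [h.g2_swap]

theorem Rel.form2_symm (h : Rel γ) {X : Fin n → Fin n → ℝ} (hX : ∀ a b, X a b = X b a) :
    form2 γ X = 0 := by
  have h1 := h.form2_swap X
  rw [show (fun a b => X b a) = X from funext fun a => funext fun b => hX b a] at h1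
  have h2 : (2 : ℝ) • form2 γ X = 0 := by
    rw [two_smul]; exact eq_neg_iff_add_eq_zero.1 h1
  simpa using h2

/-- A symmetric coefficient sees only the symmetric part δ_{ab} of γ_a γ_b, which leaves the trace.
-/
theorem Rel.sum_mul_symm (h : Rel γ) {Q : Fin n → Fin n → ℝ} (hQ : ∀ a b, Q a b = Q b a) :
    ∑ a, ∑ b, Q a b • (γ a * γ b) = (∑ a, Q a a) • (1 : A) := by
  have h1 := h.form2_symm hQ
  have h2 : ∑ a, ∑ b, Q a b • (γ a * γ b) = form2 γ Q + ∑ a, ∑ b, kron a b • Q a b • (1 : A) := by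
    simp only [form2, ← Finset.sum_add_distrib]
    refine Finset.sum_congr rfl fun a _ => Finset.sum_congr rfl fun b _ => ?_
    rw [g2]; module
  rw [h2, h1, zero_add]
  simp only [sum_kron_smul, Finset.sum_smul]

theorem form2_eq {F : Fin n → Fin n → ℝ} (hF : ∀ a b, F a b = - F b a) :
    form2 γ F = ∑ a, ∑ b, F a b • (γ a * γ b) := by
  have h0 : ∀ a, F a a = 0 := fun a => by linarith [hF a a]
  have h2 : ∑ a, ∑ b, F a b • (γ a * γ b) = form2 γ F + ∑ a, ∑ b, kron a b • F a b • (1 : A) := by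
    simp only [form2, ← Finset.sum_add_distrib]
    refine Finset.sum_congr rfl fun a _ => Finset.sum_congr rfl fun b _ => ?_
    rw [g2]; module
  rw [h2]
  simp only [sum_kron_smul, h0, zero_smul, Finset.sum_const_zero, add_zero]

theorem form2_mul_form2 (F G : Fin n → Fin n → ℝ) :
    form2 γ F * form2 γ G = form4 γ (fun a b c d => F a b * G c d)
      + form2 γ (fun a d => ∑ b, F a b * G b d) - form2 γ (fun a c => ∑ b, F a b * G c b)
      - form2 γ (fun b d => ∑ a, F a b * G a d) + form2 γ (fun b c => ∑ a, F a b * G c a)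
      + ((∑ a, ∑ b, F a b * G b a) - ∑ a, ∑ b, F a b * G a b) • (1 : A) := by
  have e : form2 γ F * form2 γ G = form4 γ (fun a b c d => F a b * G c d)
      + (∑ a, ∑ b, ∑ c, ∑ d, kron b c • (F a b * G c d) • g2 γ a d)
      - (∑ a, ∑ b, ∑ c, ∑ d, kron b d • (F a b * G c d) • g2 γ a c)
      - (∑ a, ∑ b, ∑ c, ∑ d, kron a c • (F a b * G c d) • g2 γ b d)
      + (∑ a, ∑ b, ∑ c, ∑ d, kron a d • (F a b * G c d) • g2 γ b c)
      + (∑ a, ∑ b, ∑ c, ∑ d, kron b c • kron a d • (F a b * G c d) • (1 : A))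
      - (∑ a, ∑ b, ∑ c, ∑ d, kron a c • kron b d • (F a b * G c d) • (1 : A)) := by
    simp only [form2, form4, Finset.sum_mul]
    simp only [Finset.mul_sum, ← Finset.sum_sub_distrib, ← Finset.sum_add_distrib]
    refine Finset.sum_congr rfl fun a _ => Finset.sum_congr rfl fun b _ =>
      Finset.sum_congr rfl fun c _ => Finset.sum_congr rfl fun d _ => ?_
    rw [smul_mul_smul_comm, g2_mul_g2]
    module
  rw [e]
  simp only [← Finset.smul_sum, sum_kron_smul, form2, Finset.sum_smul, sub_smul]
  have c1 : ∑ a, ∑ b, ∑ d, (F a b * G b d) • g2 γ a d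
      = ∑ a, ∑ d, ∑ b, (F a b * G b d) • g2 γ a d :=
    Finset.sum_congr rfl fun a _ => Finset.sum_comm
  have c2 : ∑ a, ∑ b, ∑ c, (F a b * G c b) • g2 γ a c
      = ∑ a, ∑ c, ∑ b, (F a b * G c b) • g2 γ a c :=
    Finset.sum_congr rfl fun a _ => Finset.sum_comm
  have c3 : ∑ a, ∑ b, ∑ d, (F a b * G a d) • g2 γ b d
      = ∑ b, ∑ d, ∑ a, (F a b * G a d) • g2 γ b d := by
    rw [Finset.sum_comm]
    exact Finset.sum_congr rfl fun a _ => Finset.sum_comm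
  have c4 : ∑ a, ∑ b, ∑ c, (F a b * G c a) • g2 γ b c
      = ∑ b, ∑ c, ∑ a, (F a b * G c a) • g2 γ b c := by
    rw [Finset.sum_comm]
    exact Finset.sum_congr rfl fun a _ => Finset.sum_comm
  rw [c1, c2, c3, c4]
  module

/-- All single contractions of F with itself are symmetric matrices, so the degree-two part
vanishes. -/
theorem Rel.form2_sq (h : Rel γ) {F : Fin n → Fin n → ℝ} (hF : ∀ a b, F a b = - F b a) :
    form2 γ F * form2 γ F = form4 γ (fun a b c d => F a b * F c d)
      - (2 * ∑ a, ∑ b, F a b * F a b) • (1 : A) := by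
  rw [form2_mul_form2]
  have s1 : form2 γ (fun a d => ∑ b, F a b * F b d) = 0 := h.form2_symm fun a d =>
    Finset.sum_congr rfl fun b _ => by rw [hF a b, hF b d]; ring
  have s2 : form2 γ (fun a c => ∑ b, F a b * F c b) = 0 := h.form2_symm fun a d =>
    Finset.sum_congr rfl fun b _ => mul_comm _ _
  have s3 : form2 γ (fun b d => ∑ a, F a b * F a d) = 0 := h.form2_symm fun a d =>
    Finset.sum_congr rfl fun b _ => mul_comm _ _
  have s4 : form2 γ (fun b c => ∑ a, F a b * F c a) = 0 := h.form2_symm fun a d =>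
    Finset.sum_congr rfl fun b _ => by rw [hF b a, hF d b]; ring
  have s5 : ∑ a, ∑ b, F a b * F b a = - ∑ a, ∑ b, F a b * F a b := by
    simp only [← Finset.sum_neg_distrib]
    refine Finset.sum_congr rfl fun a _ => Finset.sum_congr rfl fun b _ => ?_
    rw [hF b a]; ring
  rw [s1, s2, s3, s4, s5]
  module

/-! ### The square of a three-form -/

theorem sum_rotate {B : Type*} [AddCommMonoid B] (f : Fin n → Fin n → Fin n → B) :
    ∑ a, ∑ b, ∑ c, f a b c = ∑ c, ∑ a, ∑ b, f a b c := by
  rw [Finset.sum_comm (γ := Fin n) (f := fun c a => ∑ b, f a b c)]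
  exact Finset.sum_congr rfl fun a _ => Finset.sum_comm

theorem form3_eq_mul (S : Fin n → Fin n → Fin n → ℝ) (hl : ∀ a b c, S a b c = - S b a c)
    (hr : ∀ a b c, S a b c = - S a c b) : form3 γ S = ∑ a, γ a * form2 γ (S a) := by
  have e : ∑ a, γ a * form2 γ (S a) = form3 γ S + (∑ a, ∑ b, ∑ c, kron a b • S a b c • γ c)
      - ∑ a, ∑ b, ∑ c, kron a c • S a b c • γ b := by
    simp only [form2, form3, Finset.mul_sum, ← Finset.sum_sub_distrib, ← Finset.sum_add_distrib]
    refine Finset.sum_congr rfl fun a _ => Finset.sum_congr rfl fun b _ =>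
      Finset.sum_congr rfl fun c _ => ?_
    rw [mul_smul_comm, mul_g2]; module
  have h0 : ∀ a c, S a a c = 0 := fun a c => by linarith [hl a a c]
  have h1 : ∀ a b, S a b a = 0 := fun a b => by rw [hr, h0, neg_zero]
  rw [e]
  simp only [← Finset.smul_sum, sum_kron_smul, h0, h1, zero_smul, Finset.sum_const_zero, add_zero,
    sub_zero]

/-- This avoids products of degree above four. With X = ∑ γ_a F_a and X γ_a + γ_a X = 6 F_a, one
gets X² = 6 ∑ F_a² - ∑ γ_a X F_a. Moving X to the right through F_a turns the last sum into X² - 12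
∑ F_a² - 24 |S|². Solving for 2X² gives the result. -/
theorem Rel.form3_sq (h : Rel γ) (S : Fin n → Fin n → Fin n → ℝ)
    (hl : ∀ a b c, S a b c = - S b a c) (hr : ∀ a b c, S a b c = - S a c b) :
    form3 γ S * form3 γ S = (9 : ℝ) • (∑ a, form2 γ (S a) * form2 γ (S a))
      + (12 * ∑ a, ∑ b, ∑ c, S a b c * S a b c) • (1 : A) := by
  set X := form3 γ S with hX
  set F := fun a => form2 γ (S a) with hF
  change X * X = (9 : ℝ) • (∑ a, F a * F a) + _
  have hcyc : ∀ a b c, S a b c = S c a b := fun a b c => by rw [hr, hl, neg_neg]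
  have hXF : X = ∑ a, γ a * F a := form3_eq_mul S hl hr
  have hac : ∀ a, X * γ a = (6 : ℝ) • F a - γ a * X := fun a => by
    rw [eq_sub_iff_add_eq, add_comm]; exact h.anticommutator_sum_g3 hl hr a
  have hco : ∀ k j, F k * γ j = γ j * F k - (4 : ℝ) • ∑ l, S k j l • γ l := fun k j => by
    rw [eq_sub_iff_add_eq, add_comm, ← eq_sub_iff_add_eq]
    exact (h.commutator_sum_g2 (hr k) j).symm
  have hFm : ∀ a, F a = ∑ j, ∑ k, S a j k • (γ j * γ k) := fun a => form2_eq (hr a)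
  -- the commutator of `X` with `F a`
  have hXc : ∀ a, X * F a = F a * X
      + ∑ j, ∑ k, S a j k • ((6 : ℝ) • (F j * γ k) - (6 : ℝ) • (γ j * F k)) := fun a => by
    conv_lhs => rw [hFm a]
    conv_rhs => rw [hFm a]
    simp only [Finset.mul_sum, Finset.sum_mul, mul_smul_comm, smul_mul_assoc,
      ← Finset.sum_add_distrib, ← smul_add]
    refine Finset.sum_congr rfl fun j _ => Finset.sum_congr rfl fun k _ => ?_
    rw [← mul_assoc, hac, sub_mul, mul_assoc (γ j), hac, mul_sub, smul_mul_assoc, mul_smul_comm,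
      mul_assoc]
    congr 1; abel
  have hFg : ∀ a, ∑ j, ∑ k, S a j k • (F j * γ k) = - ∑ j, ∑ k, S a j k • (F k * γ j) := by
    intro a
    rw [Finset.sum_comm]
    simp only [← Finset.sum_neg_distrib]
    refine Finset.sum_congr rfl fun j _ => Finset.sum_congr rfl fun k _ => ?_
    rw [hr a k j, neg_smul]
  have hFg2 : ∀ a, ∑ j, ∑ k, S a j k • (F k * γ j) = (∑ j, ∑ k, S a j k • (γ j * F k))
      - (4 : ℝ) • ∑ j, ∑ k, S a j k • ∑ l, S k j l • γ l := by
    intro a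
    simp only [Finset.smul_sum (r := (4 : ℝ)) , ← Finset.sum_sub_distrib]
    refine Finset.sum_congr rfl fun j _ => Finset.sum_congr rfl fun k _ => ?_
    rw [hco, smul_sub, smul_comm (4 : ℝ), Finset.smul_sum (r := (4 : ℝ))]
  have hXc2 : ∀ a, X * F a = F a * X - (12 : ℝ) • (∑ j, ∑ k, S a j k • (γ j * F k))
      + (24 : ℝ) • ∑ j, ∑ k, S a j k • ∑ l, S k j l • γ l := fun a => by
    rw [hXc]
    simp only [smul_sub, Finset.sum_sub_distrib, smul_comm _ (6 : ℝ), ← Finset.smul_sum (r := (6 : ℝ))]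
    rw [hFg, hFg2]
    module
  -- Cyclic symmetry of S lets γ_a γ_j S_{ajk} be read as F_k.
  have hA : ∑ a, γ a * ∑ j, ∑ k, S a j k • (γ j * F k) = ∑ k, F k * F k := by
    simp only [Finset.mul_sum, mul_smul_comm]
    have : ∀ k, F k * F k = ∑ a, ∑ j, S a j k • (γ a * (γ j * F k)) := fun k => by
      conv_lhs => rw [hFm k]
      simp only [Finset.sum_mul, smul_mul_assoc, mul_assoc]
      refine Finset.sum_congr rfl fun j _ => Finset.sum_congr rfl fun l _ => ?_
      rw [hcyc j l k]
      conv_lhs => rw [← hFm k]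
    simp only [this]
    rw [Finset.sum_comm (γ := Fin n) (s := Finset.univ) (t := Finset.univ)
      (f := fun k a => ∑ j, S a j k • (γ a * (γ j * F k)))]
    exact Finset.sum_congr rfl fun a _ => Finset.sum_comm
  -- The contraction of S with itself over two indices is symmetric in the remaining pair, so only
  -- its trace |S|² survives, with a minus sign from reordering the indices of S.
  have hB : ∑ a, γ a * ∑ j, ∑ k, S a j k • ∑ l, S k j l • γ l
      = - (∑ a, ∑ b, ∑ c, S a b c * S a b c) • (1 : A) := by
    have hQ := h.sum_mul_symm (Q := fun a l => ∑ j, ∑ k, S a j k * S l j k)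
      (fun a l => Finset.sum_congr rfl fun j _ => Finset.sum_congr rfl fun k _ => mul_comm _ _)
    rw [neg_smul, ← hQ, ← Finset.sum_neg_distrib]
    refine Finset.sum_congr rfl fun a _ => ?_
    have : ∀ k j l, S k j l = - S l j k := fun k j l => by rw [hcyc k j l, hr]
    simp only [Finset.mul_sum, Finset.sum_smul, mul_smul_comm, Finset.smul_sum, smul_smul,
      ← Finset.sum_neg_distrib]
    rw [sum_rotate]
    refine Finset.sum_congr rfl fun l _ => Finset.sum_congr rfl fun j _ =>
      Finset.sum_congr rfl fun k _ => ?_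
    rw [this k j l, mul_neg, neg_smul]
  have hC : X * X = (6 : ℝ) • (∑ a, F a * F a) - ∑ a, γ a * (X * F a) := by
    conv_lhs => rw [hXF]
    rw [← hXF, hXF, Finset.mul_sum, ← hXF, Finset.smul_sum, ← Finset.sum_sub_distrib]
    refine Finset.sum_congr rfl fun a _ => ?_
    rw [← mul_assoc, hac, sub_mul, smul_mul_assoc, mul_assoc]
  have hD : ∑ a, γ a * (X * F a) = X * X - (12 : ℝ) • (∑ a, F a * F a)
      - (24 * ∑ a, ∑ b, ∑ c, S a b c * S a b c) • (1 : A) := by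
    simp only [hXc2, mul_add, mul_sub, mul_smul_comm, Finset.sum_add_distrib,
      Finset.sum_sub_distrib, ← Finset.smul_sum (r := (12 : ℝ)), ← Finset.smul_sum (r := (24 : ℝ))]
    rw [hA, hB]
    simp only [← mul_assoc, ← Finset.sum_mul, ← hXF]
    module
  rw [hD] at hC
  have h2 : (2 : ℝ) • (X * X) = (2 : ℝ) • ((9 : ℝ) • (∑ a, F a * F a)
      + (12 * ∑ a, ∑ b, ∑ c, S a b c * S a b c) • (1 : A)) := by
    rw [two_smul]
    nth_rewrite 1 [hC]
    module
  exact smul_right_injective A (two_ne_zero) h2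

/-! ### The Clifford expansion of the quadratic expressions in the connection -/

/-- Everything comes from `g2_mul_g2`. The single contractions give -2 E_a W_{bdd} - 2 E_c W_{cba}
under γ^{[a}γ^{b]}. Half of each is rewritten with a and b exchanged, so that the two-form
coefficient is antisymmetric, as `Rel.mem_iff_coeff_mem` requires. -/
theorem Rel.sum_g2_mul_form2 (h : Rel γ) {W : Fin n → Fin n → Fin n → ℝ}
    (hW : ∀ a b c, W a b c = - W b a c) (E : Fin n → ℝ) :
    ∑ c, ∑ d, E c • (g2 γ c d * form2 γ (fun j k => W j k d)) =
      (-2 * ∑ c, ∑ d, E c * W c d d) • (1 : A)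
      + form2 γ (fun a b => - ∑ d, E a * W b d d + ∑ d, E b * W a d d
          + ∑ c, E c * W c a b - ∑ c, E c * W c b a)
      + form4 γ (fun c d j k => E c * W j k d) := by
  have e : ∑ c, ∑ d, E c • (g2 γ c d * form2 γ (fun j k => W j k d)) =
      form4 γ (fun c d j k => E c * W j k d)
      + (∑ c, ∑ d, ∑ j, ∑ k, kron d j • (E c * W j k d) • g2 γ c k)
      - (∑ c, ∑ d, ∑ j, ∑ k, kron d k • (E c * W j k d) • g2 γ c j)
      - (∑ c, ∑ d, ∑ j, ∑ k, kron c j • (E c * W j k d) • g2 γ d k)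
      + (∑ c, ∑ d, ∑ j, ∑ k, kron c k • (E c * W j k d) • g2 γ d j)
      + (∑ c, ∑ d, ∑ j, ∑ k, kron d j • kron c k • (E c * W j k d) • (1 : A))
      - (∑ c, ∑ d, ∑ j, ∑ k, kron c j • kron d k • (E c * W j k d) • (1 : A)) := by
    simp only [form2, form4, Finset.mul_sum, Finset.smul_sum, ← Finset.sum_sub_distrib,
      ← Finset.sum_add_distrib]
    refine Finset.sum_congr rfl fun a _ => Finset.sum_congr rfl fun b _ =>
      Finset.sum_congr rfl fun c _ => Finset.sum_congr rfl fun d _ => ?_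
    rw [mul_smul_comm, g2_mul_g2]
    module
  rw [e]
  simp only [← Finset.smul_sum, sum_kron_smul]
  have e1 : ∑ c, ∑ d, ∑ k, (E c * W d k d) • g2 γ c k
      = - form2 γ (fun a b => ∑ d, E a * W b d d) := by
    simp only [form2, Finset.sum_smul, ← Finset.sum_neg_distrib]
    refine Finset.sum_congr rfl fun c _ => ?_
    rw [Finset.sum_comm]
    refine Finset.sum_congr rfl fun k _ => Finset.sum_congr rfl fun d _ => ?_
    rw [hW]; module
  have e2 : ∑ c, ∑ d, ∑ k, (E c * W k d d) • g2 γ c k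
      = form2 γ (fun a b => ∑ d, E a * W b d d) := by
    simp only [form2, Finset.sum_smul]
    exact Finset.sum_congr rfl fun c _ => Finset.sum_comm
  have e3 : ∑ c, ∑ d, ∑ k, (E c * W c k d) • g2 γ d k
      = form2 γ (fun a b => ∑ c, E c * W c b a) := by
    simp only [form2, Finset.sum_smul]
    rw [sum_rotate, sum_rotate]
  have e4 : ∑ c, ∑ d, ∑ k, (E c * W k c d) • g2 γ d k
      = - form2 γ (fun a b => ∑ c, E c * W c b a) := by
    rw [← e3]
    simp only [← Finset.sum_neg_distrib]
    refine Finset.sum_congr rfl fun c _ => Finset.sum_congr rfl fun k _ =>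
      Finset.sum_congr rfl fun d _ => ?_
    rw [hW]; module
  have e5 : ∑ c, ∑ d, (E c * W d c d) • (1 : A) = - (∑ c, ∑ d, E c * W c d d) • (1 : A) := by
    simp only [neg_smul, Finset.sum_smul, ← Finset.sum_neg_distrib]
    refine Finset.sum_congr rfl fun c _ => Finset.sum_congr rfl fun d _ => ?_
    rw [hW]; module
  have e6 : ∑ c, ∑ d, (E c * W c d d) • (1 : A) = (∑ c, ∑ d, E c * W c d d) • (1 : A) := by
    simp only [Finset.sum_smul]
  have e7 : form2 γ (fun a b => - ∑ d, E a * W b d d + ∑ d, E b * W a d d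
          + ∑ c, E c * W c a b - ∑ c, E c * W c b a)
      = - form2 γ (fun a b => ∑ d, E a * W b d d) + form2 γ (fun a b => ∑ d, E b * W a d d)
        + form2 γ (fun a b => ∑ c, E c * W c a b) - form2 γ (fun a b => ∑ c, E c * W c b a) := by
    simp only [form2, sub_smul, add_smul, neg_smul, Finset.sum_add_distrib, Finset.sum_sub_distrib,
      Finset.sum_neg_distrib]
  rw [e1, e2, e3, e4, e5, e6, e7, h.form2_swap (fun a b => ∑ d, E a * W b d d),
    h.form2_swap (fun a b => ∑ c, E c * W c b a)]
  module

theorem Rel.form3_rotate (h : Rel γ) (X : Fin n → Fin n → Fin n → ℝ) :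
    form3 γ (fun a b c => X b c a) = form3 γ X := by
  rw [form3, ← sum_rotate (f := fun b c a => X b c a • g3 γ a b c)]
  refine Finset.sum_congr rfl fun a _ => Finset.sum_congr rfl fun b _ =>
    Finset.sum_congr rfl fun c _ => ?_
  rw [h.g3_swap_left, h.g3_swap_right, neg_neg]

/-- The sum over cyclic permutations of the indices. -/
def cycSum (W : Fin n → Fin n → Fin n → ℝ) (a b c : Fin n) : ℝ := W b c a + W c a b + W a b c

theorem cycSum_sq (W : Fin n → Fin n → Fin n → ℝ) :
    ∑ a, ∑ b, ∑ c, cycSum W a b c * cycSum W a b c =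
      3 * (∑ a, ∑ b, ∑ c, W a b c * W a b c) + 6 * ∑ a, ∑ b, ∑ c, W a b c * W b c a := by
  have r : ∀ f : Fin n → Fin n → Fin n → ℝ, ∑ a, ∑ b, ∑ c, f b c a = ∑ a, ∑ b, ∑ c, f a b c :=
    fun f => (sum_rotate (fun b c a => f b c a)).symm
  have n1 := r fun a b c => W a b c * W a b c
  have n2 := r fun a b c => W b c a * W b c a
  have k1 := r fun a b c => W a b c * W b c a
  have k2 := r fun a b c => W b c a * W c a b
  have : ∀ a b c, cycSum W a b c * cycSum W a b c = W b c a * W b c a + W c a b * W c a b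
      + W a b c * W a b c + 2 * (W b c a * W c a b) + 2 * (W c a b * W a b c)
      + 2 * (W a b c * W b c a) := fun a b c => by
    simp only [cycSum]; ring
  simp only [this, Finset.sum_add_distrib, ← Finset.mul_sum]
  linarith

/-- Permuting indices inside a degree-four sum only changes signs. Apart from the trace term, all
products therefore reduce to W_{rab} W_{rcd}, W_{abr} W_{rcd} and W_{abr} W_{cdr}. The last type
cancels against the subtracted squares. -/
theorem Rel.form4_cycSum (h : Rel γ) {W : Fin n → Fin n → Fin n → ℝ}
    (hW : ∀ a b c, W a b c = - W b a c) :
    (∑ r, form4 γ (fun a b c d => cycSum W r a b * cycSum W r c d))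
      + (4 : ℝ) • form4 γ (fun m c j k => (∑ r, W m r r) * W j k c)
      - ∑ r, form4 γ (fun a b c d => W a b r * W c d r) =
    (4 : ℝ) • form4 γ (fun m n p q => ∑ r, (W m r r * W p q n - W p q r * W r n m
      + W m r p * W r n q)) := by
  have t : form4 γ (fun m c j k => (∑ r, W m r r) * W j k c)
      = ∑ r, form4 γ (fun m c j k => W m r r * W j k c) := by
    simp only [Finset.sum_mul, form4_sum]
  rw [form4_sum, t]
  simp only [Finset.smul_sum, ← Finset.sum_add_distrib, ← Finset.sum_sub_distrib]
  refine Finset.sum_congr rfl fun r _ => ?_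
  rw [form4_add, form4_sub]
  set Pa := form4 γ (fun a b c d => W r a b * W r c d) with hPa
  set Pb := form4 γ (fun a b c d => W a b r * W r c d) with hPb
  have e1 : form4 γ (fun m n p q => W m r p * W r n q) = Pa := by
    rw [← neg_neg Pa, hPa, ← h.form4_swap_mid, ← form4_neg]
    congr 1; funext a b c d; rw [hW a r c]; ring
  have e2 : form4 γ (fun m n p q => W p q r * W r n m) = - Pb := by
    have s1 := h.form4_swap_left (fun a b c d => W c d r * W r a b)
    rw [s1, hPb]
    have s2 := h.form4_swap_mid (fun a b c d => W a b r * W r c d)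
    have s3 := h.form4_swap_left (fun a b c d => W a c r * W r b d)
    have s4 := h.form4_swap_right (fun a b c d => W b c r * W r a d)
    have s5 := h.form4_swap_mid (fun a b c d => W b d r * W r a c)
    rw [s5, s4, s3, s2]; simp
  have e4 : form4 γ (fun a b c d => W r a b * W c d r) = Pb := by
    rw [← neg_neg Pb, ← e2, ← h.form4_swap_left]
    congr 1; funext a b c d; ring
  have key : form4 γ (fun a b c d => cycSum W r a b * cycSum W r c d)
      = (4 : ℝ) • Pa + (4 : ℝ) • Pb + form4 γ (fun a b c d => W a b r * W c d r) := by
    have x1 := h.form4_swap_left (fun a b c d => W r a b * W r c d)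
    have x2 := h.form4_swap_right (fun a b c d => W r a b * W r c d)
    have x3 := h.form4_swap_right (fun a b c d => W r b a * W r c d)
    have x4 := h.form4_swap_left (fun a b c d => W r a b * W c d r)
    have x5 := h.form4_swap_right (fun a b c d => W a b r * W r c d)
    have ex : form4 γ (fun a b c d => cycSum W r a b * cycSum W r c d)
        = form4 γ (fun a b c d => W r a b * W r c d) - form4 γ (fun a b c d => W r b a * W r c d)
          - form4 γ (fun a b c d => W r a b * W r d c) + form4 γ (fun a b c d => W r b a * W r d c)
          + form4 γ (fun a b c d => W r a b * W c d r) - form4 γ (fun a b c d => W r b a * W c d r)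
          + form4 γ (fun a b c d => W a b r * W r c d) - form4 γ (fun a b c d => W a b r * W r d c)
          + form4 γ (fun a b c d => W a b r * W c d r) := by
      simp only [← form4_add, ← form4_sub]
      congr 1; funext a b c d
      simp only [cycSum]
      rw [hW b r a, hW d r c]; ring
    rw [ex, x3, x1, x2, x4, x5, e4, ← hPa, ← hPb]
    module
  rw [key, e1, e2]
  module

theorem scalar_part {W : Fin n → Fin n → Fin n → ℝ} (hW : ∀ a b c, W a b c = - W b a c) :
    ∑ a, ∑ b, ∑ c, (W a c a * W c b b - W a c b * W c b a) =
      - (∑ c, (∑ d, W c d d) * ∑ d, W c d d) - ∑ a, ∑ b, ∑ c, W a b c * W b c a := by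
  simp only [Finset.sum_sub_distrib]
  congr 1
  · rw [sum_rotate, ← Finset.sum_neg_distrib]
    refine Finset.sum_congr rfl fun c _ => ?_
    rw [Finset.sum_mul_sum, ← Finset.sum_neg_distrib]
    refine Finset.sum_congr rfl fun a _ => ?_
    rw [← Finset.sum_neg_distrib]
    refine Finset.sum_congr rfl fun b _ => ?_
    rw [hW a c a]; ring
  · exact Finset.sum_congr rfl fun a _ => Finset.sum_comm

/-- Write O_c for the two-form of W_{··c}. Since γ^{[c}γ^{d]} = γᶜγᵈ - δᶜᵈ, the sum is (∑ O_c γ_c)(∑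
γ_d O_d) - ∑ O_c². The factors are θ + 2t and θ - 2t, with θ the three-form of W and t its trace
vector, so the product is θ² + 2(tθ - θt) - 4t². Here tθ - θt is purely of degree four, t² is
scalar, and the squares of two- and three-forms have only degrees zero and four. Hence there is no
two-form part. -/
theorem Rel.sum_form2_mul_g2_mul_form2 (h : Rel γ) {W : Fin n → Fin n → Fin n → ℝ}
    (hW : ∀ a b c, W a b c = - W b a c) :
    ∑ c, ∑ d, form2 γ (fun j k => W j k c) * (g2 γ c d * form2 γ (fun j k => W j k d)) =
      (4 * ∑ a, ∑ b, ∑ c, (W a c a * W c b b - W a c b * W c b a)) • (1 : A)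
      + (4 : ℝ) • form4 γ (fun m n p q => ∑ r, (W m r r * W p q n - W p q r * W r n m
        + W m r p * W r n q)) := by
  set O : Fin n → A := fun d => form2 γ (fun j k => W j k d) with hO
  set θ := form3 γ (fun c j k => W j k c) with hθ
  set τ : Fin n → ℝ := fun j => ∑ d, W j d d with hτ
  set t : A := ∑ j, τ j • γ j with ht
  have hWt : ∑ c, ∑ k, W c k c • γ k = - t := by
    rw [ht, Finset.sum_comm, ← Finset.sum_neg_distrib]
    refine Finset.sum_congr rfl fun k _ => ?_
    rw [hτ, Finset.sum_smul, ← Finset.sum_neg_distrib]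
    refine Finset.sum_congr rfl fun c _ => ?_
    rw [hW, neg_smul]
  have hWt' : ∑ c, ∑ j, W j c c • γ j = t := by
    rw [ht, Finset.sum_comm]
    refine Finset.sum_congr rfl fun k _ => ?_
    rw [hτ, Finset.sum_smul]
  have h1 : ∑ c, O c * γ c = θ + (2 : ℝ) • t := by
    have e : ∑ c, O c * γ c = θ - (∑ c, ∑ j, ∑ k, kron c j • W j k c • γ k)
        + ∑ c, ∑ j, ∑ k, kron c k • W j k c • γ j := by
      simp only [hO, hθ, form2, form3, Finset.sum_mul, ← Finset.sum_sub_distrib,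
        ← Finset.sum_add_distrib]
      refine Finset.sum_congr rfl fun c _ => Finset.sum_congr rfl fun j _ =>
        Finset.sum_congr rfl fun k _ => ?_
      have := h.commutator_g2 c j k
      rw [mul_g2, sub_eq_iff_eq_add, ← sub_eq_iff_eq_add'] at this
      rw [smul_mul_assoc, ← this]; module
    rw [e]
    simp only [← Finset.smul_sum, sum_kron_smul]
    rw [hWt, hWt']; module
  have h2 : ∑ d, γ d * O d = θ - (2 : ℝ) • t := by
    have e : ∑ d, γ d * O d = θ + (∑ c, ∑ j, ∑ k, kron c j • W j k c • γ k)
        - ∑ c, ∑ j, ∑ k, kron c k • W j k c • γ j := by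
      simp only [hO, hθ, form2, form3, Finset.mul_sum, ← Finset.sum_sub_distrib,
        ← Finset.sum_add_distrib]
      refine Finset.sum_congr rfl fun c _ => Finset.sum_congr rfl fun j _ =>
        Finset.sum_congr rfl fun k _ => ?_
      rw [mul_smul_comm, mul_g2]; module
    rw [e]
    simp only [← Finset.smul_sum, sum_kron_smul]
    rw [hWt, hWt']; module
  have h3 : ∑ c, ∑ d, O c * (g2 γ c d * O d) = (∑ c, O c * γ c) * (∑ d, γ d * O d)
      - ∑ c, O c * O c := by
    rw [Finset.sum_mul_sum, ← Finset.sum_sub_distrib]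
    refine Finset.sum_congr rfl fun c _ => ?_
    rw [← sum_kron_smul c fun d => O c * O d, ← Finset.sum_sub_distrib]
    refine Finset.sum_congr rfl fun d _ => ?_
    simp only [g2, sub_mul, mul_sub, smul_mul_assoc, one_mul, mul_smul_comm, mul_assoc]
  have h4 : t * θ - θ * t = (2 : ℝ) • form4 γ (fun m c j k => τ m * W j k c) := by
    rw [ht, Finset.sum_mul, Finset.mul_sum, ← Finset.sum_sub_distrib, form4, Finset.smul_sum]
    refine Finset.sum_congr rfl fun m _ => ?_
    simp only [hθ, form3, Finset.sum_mul, Finset.mul_sum, ← Finset.sum_sub_distrib, Finset.smul_sum]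
    refine Finset.sum_congr rfl fun c _ => Finset.sum_congr rfl fun j _ =>
        Finset.sum_congr rfl fun k _ => ?_
    have := h.anticommutator_g3 m c j k
    rw [mul_g3, ← eq_sub_iff_add_eq'] at this
    rw [smul_mul_smul_comm, smul_mul_smul_comm, mul_g3, this]
    module
  have h5 : t * t = (∑ c, τ c * τ c) • (1 : A) := by
    rw [← h.sum_mul_symm (Q := fun a b => τ a * τ b) fun a b => mul_comm _ _]
    simp only [ht, Finset.sum_mul_sum, smul_mul_smul_comm]
  have h6 : ∀ c, O c * O c = form4 γ (fun j k l m => W j k c * W l m c)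
      - (2 * ∑ j, ∑ k, W j k c * W j k c) • (1 : A) := fun c =>
    h.form2_sq (F := fun j k => W j k c) fun j k => hW j k c
  -- As W is antisymmetric in its first two indices, its cyclic sum is totally antisymmetric. It
  -- represents 3θ, so `Rel.form3_sq` applies to it without dividing by 3!.
  have hSl : ∀ a b c, cycSum W a b c = - cycSum W b a c := fun a b c => by
    simp only [cycSum]; rw [hW b c a, hW c a b, hW a b c]; ring
  have hSr : ∀ a b c, cycSum W a b c = - cycSum W a c b := fun a b c => by
    simp only [cycSum]; rw [hW b c a, hW c a b, hW a b c]; ring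
  have h7 : form3 γ (cycSum W) = (3 : ℝ) • θ := by
    have r1 : form3 γ (fun a b c => W c a b) = θ := by
      have := h.form3_rotate (fun c j k => W j k c)
      exact this
    have r2 : form3 γ (fun a b c => W a b c) = θ := by
      have := h.form3_rotate (fun a b c => W c a b)
      exact this.trans r1
    have : form3 γ (cycSum W) = θ + form3 γ (fun a b c => W c a b)
        + form3 γ (fun a b c => W a b c) := by
      simp only [hθ, form3, cycSum, add_smul, Finset.sum_add_distrib]
    rw [this, r1, r2]; module
  have h8 := h.form3_sq (cycSum W) hSl hSr
  have h9 : ∀ a, form2 γ (cycSum W a) * form2 γ (cycSum W a) =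
      form4 γ (fun j k l m => cycSum W a j k * cycSum W a l m)
      - (2 * ∑ j, ∑ k, cycSum W a j k * cycSum W a j k) • (1 : A) := fun a =>
    h.form2_sq (F := cycSum W a) (hSr a)
  rw [h7, cycSum_sq] at h8
  simp only [h9, smul_mul_smul_comm, Finset.sum_sub_distrib, ← Finset.sum_smul,
    ← Finset.mul_sum] at h8
  rw [cycSum_sq] at h8
  have h10 : θ * θ = (1 / 9 : ℝ) • (((3 : ℝ) * 3) • (θ * θ)) := by module
  have h11 := h.form4_cycSum hW
  rw [h3, h1, h2, scalar_part hW]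
  have h12 : (θ + (2 : ℝ) • t) * (θ - (2 : ℝ) • t)
      = θ * θ + (2 : ℝ) • (t * θ - θ * t) - (4 : ℝ) • (t * t) := by
    simp only [add_mul, mul_sub, smul_mul_assoc, mul_smul_comm]; module
  rw [h12, h10, h8, h4, h5, ← h11]
  simp only [h6, Finset.sum_sub_distrib, ← Finset.sum_smul, ← Finset.mul_sum]
  rw [← sum_rotate fun j k i => W j k i * W j k i]
  -- In the scalar part, the square norms of W from θ² and from ∑ O_c² cancel, leaving only the
  -- trace square and the cyclic product W_{abc} W_{bca}.
  module

end Gamma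

/-! ### Antisymmetrization and recovery of the Clifford coefficients -/

theorem Alt_comp_perm {n p : ℕ} (T : (Fin p → Fin n) → ℝ) (k : Fin p → Fin n)
    (s : Equiv.Perm (Fin p)) : Alt T (k ∘ s) = ((Equiv.Perm.sign s : ℤ) : ℝ) * Alt T k := by
  unfold Alt
  rw [mul_left_comm]
  congr 1
  rw [Finset.mul_sum]
  refine Fintype.sum_equiv (Equiv.mulLeft s) _ _ fun t => ?_
  have h1 : ((Equiv.Perm.sign s : ℤ) : ℝ) * ((Equiv.Perm.sign s : ℤ) : ℝ) = 1 := by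
    rw [← Int.cast_mul, ← Units.val_mul, Int.units_mul_self]; simp
  simp only [Equiv.coe_mulLeft, Equiv.Perm.sign_mul, Units.val_mul, Int.cast_mul,
    Equiv.Perm.coe_mul, Function.comp_assoc]
  rw [← mul_assoc, ← mul_assoc, h1, one_mul]

theorem Alt_swap {n p : ℕ} (T : (Fin p → Fin n) → ℝ) {i j : Fin p} (hij : i ≠ j)
    (k : Fin p → Fin n) : Alt T k = - Alt T (k ∘ Equiv.swap i j) := by
  rw [Alt_comp_perm, Equiv.Perm.sign_swap hij]; simp

theorem cons4_swap_left {α : Type*} (a b c d : α) :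
    ![a, b, c, d] ∘ Equiv.swap (0 : Fin 4) 1 = ![b, a, c, d] := by
  ext i; fin_cases i <;> rfl

theorem cons4_swap_mid {α : Type*} (a b c d : α) :
    ![a, b, c, d] ∘ Equiv.swap (1 : Fin 4) 2 = ![a, c, b, d] := by
  ext i; fin_cases i <;> rfl

theorem cons4_swap_right {α : Type*} (a b c d : α) :
    ![a, b, c, d] ∘ Equiv.swap (2 : Fin 4) 3 = ![a, b, d, c] := by
  ext i; fin_cases i <;> rfl

namespace Gamma

variable {n : ℕ} {A : Type*} [Ring A] [Algebra ℝ A] {γ : Fin n → A}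

/-- Adjacent transpositions generate the symmetric group, so the three swap lemmas suffice. -/
theorem Rel.form4_perm (h : Rel γ) (s : Equiv.Perm (Fin 4)) (T : (Fin 4 → Fin n) → ℝ) :
    form4 γ (fun a b c d => T (![a, b, c, d] ∘ s)) =
      ((Equiv.Perm.sign s : ℤ) : ℝ) • form4 γ (fun a b c d => T ![a, b, c, d]) := by
  have hs : s ∈ Submonoid.closure
      (Set.range fun i : Fin 3 => Equiv.swap i.castSucc i.succ) := by
    rw [Equiv.Perm.mclosure_swap_castSucc_succ]; trivial
  induction hs using Submonoid.closure_induction generalizing T with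
  | mem s hs =>
    obtain ⟨i, rfl⟩ := hs
    have hi : i.castSucc ≠ i.succ := (Fin.castSucc_lt_succ).ne
    simp only [Equiv.Perm.sign_swap hi]
    fin_cases i
    · refine Eq.trans ?_ ((h.form4_swap_left fun a b c d => T ![a, b, c, d]).trans (by simp))
      congr 1; funext a b c d; exact congrArg T (cons4_swap_left a b c d)
    · refine Eq.trans ?_ ((h.form4_swap_mid fun a b c d => T ![a, b, c, d]).trans (by simp))
      congr 1; funext a b c d; exact congrArg T (cons4_swap_mid a b c d)
    · refine Eq.trans ?_ ((h.form4_swap_right fun a b c d => T ![a, b, c, d]).trans (by simp))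
      congr 1; funext a b c d; exact congrArg T (cons4_swap_right a b c d)
  | one => simp
  | mul s t _ _ ihs iht =>
    have h1 := ihs (fun k => T (k ∘ t))
    simp only [Equiv.Perm.coe_mul, ← Function.comp_assoc]
    rw [h1, iht, smul_smul]; simp

/-- By `Rel.form4_perm` all 4! terms of the antisymmetrization contribute the same element, the two
signs of each permutation cancelling. -/
theorem Rel.form4_Alt (h : Rel γ) (T : (Fin 4 → Fin n) → ℝ) :
    form4 γ (fun a b c d => Alt T ![a, b, c, d]) = form4 γ (fun a b c d => T ![a, b, c, d]) := by
  have e : form4 γ (fun a b c d => Alt T ![a, b, c, d]) = ((Nat.factorial 4 : ℕ) : ℝ)⁻¹ •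
      ∑ s : Equiv.Perm (Fin 4), ((Equiv.Perm.sign s : ℤ) : ℝ) •
        form4 γ (fun a b c d => T (![a, b, c, d] ∘ s)) := by
    unfold Alt
    rw [form4_smul]
    congr 1
    simp only [form4, Finset.smul_sum, smul_smul, Finset.sum_smul]
    symm
    rw [Finset.sum_comm]
    refine Finset.sum_congr rfl fun a _ => ?_
    rw [Finset.sum_comm]
    refine Finset.sum_congr rfl fun b _ => ?_
    rw [Finset.sum_comm]
    refine Finset.sum_congr rfl fun c _ => ?_
    rw [Finset.sum_comm]
  have h1 : ∀ s : Equiv.Perm (Fin 4),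
      ((Equiv.Perm.sign s : ℤ) : ℝ) * ((Equiv.Perm.sign s : ℤ) : ℝ) = 1 := fun s => by
    rw [← Int.cast_mul, ← Units.val_mul, Int.units_mul_self]; simp
  rw [e]
  simp only [h.form4_perm, smul_smul, h1, one_smul, Finset.sum_const, Finset.card_univ,
    Fintype.card_perm, Fintype.card_fin]
  rw [← Nat.cast_smul_eq_nsmul ℝ, smul_smul, inv_mul_cancel₀ (by positivity), one_smul]

/-- A space of `A`-valued functions that is stable under multiplication by elements of `A` contains
`s + B_{ab} γ^{[a} γ^{b]} + Z_{abcd} γ^{[a} γ^b γ^c γ^{d]}`, with antisymmetric coefficients, if and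
only if it contains all the coefficients. -/
theorem Rel.mem_iff_coeff_mem (h : Rel γ) {ι : Type*} (S : Submodule ℝ (ι → A))
    (hl : ∀ (a : A), ∀ X ∈ S, (fun x => a * X x) ∈ S)
    (hr : ∀ (a : A), ∀ X ∈ S, (fun x => X x * a) ∈ S)
    (s : ι → ℝ) (B : ι → Fin n → Fin n → ℝ) (hB : ∀ x a b, B x a b = - B x b a)
    (T : ι → (Fin 4 → Fin n) → ℝ) :
    (fun x => s x • (1 : A) + form2 γ (B x) + form4 γ (fun a b c d => T x ![a, b, c, d])) ∈ S ↔
      (fun x => s x • (1 : A)) ∈ S ∧ (∀ a b, (fun x => B x a b • (1 : A)) ∈ S) ∧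
        ∀ k, (fun x => Alt (T x) k • (1 : A)) ∈ S := by
  have hsm : ∀ (f : ι → ℝ) (a : A), (fun x => f x • (1 : A)) ∈ S → (fun x => f x • a) ∈ S := by
    intro f a hf
    simpa using hr a _ hf
  have hdiv : ∀ (f : ι → ℝ) (r : ℝ), r ≠ 0 → (fun x => (r * f x) • (1 : A)) ∈ S →
      (fun x => f x • (1 : A)) ∈ S := by
    intro f r hr0 hf
    have := S.smul_mem r⁻¹ hf
    convert this using 1
    funext x
    simp [smul_smul, hr0]
  have hsum : ∀ (F : Fin n → ι → A), (∀ a, F a ∈ S) → (fun x => ∑ a, F a x) ∈ S := by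
    intro F hF
    have := S.sum_mem (fun a (_ : a ∈ Finset.univ) => hF a)
    convert this using 1
    funext x; simp
  have hAlt : (fun x => form4 γ (fun a b c d => T x ![a, b, c, d])) =
      fun x => form4 γ (fun a b c d => Alt (T x) ![a, b, c, d]) :=
    funext fun x => (h.form4_Alt (T x)).symm
  have hB' : (∀ a b, (fun x => B x a b • (1 : A)) ∈ S) → (fun x => form2 γ (B x)) ∈ S := fun hb =>
    hsum _ fun a => hsum _ fun b => hsm _ _ (hb a b)
  have hT' : (∀ k, (fun x => Alt (T x) k • (1 : A)) ∈ S) →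
      (fun x => form4 γ (fun a b c d => T x ![a, b, c, d])) ∈ S := fun ht => by
    rw [hAlt]
    exact hsum _ fun a => hsum _ fun b => hsum _ fun c => hsum _ fun d => hsm _ _ (ht _)
  constructor
  · intro hX
    have hcomm : ∀ a, ∀ X ∈ S, (fun x => γ a * X x - X x * γ a) ∈ S := fun a X hX =>
      S.sub_mem (hl _ _ hX) (hr _ _ hX)
    have hanti : ∀ a, ∀ X ∈ S, (fun x => γ a * X x + X x * γ a) ∈ S := fun a X hX =>
      S.add_mem (hl _ _ hX) (hr _ _ hX)
    have zl : ∀ x a b c d, Alt (T x) ![a, b, c, d] = - Alt (T x) ![b, a, c, d] :=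
      fun x a b c d => by
        rw [Alt_swap (T x) (i := 0) (j := 1) (by decide) ![a, b, c, d], cons4_swap_left]
    have zm : ∀ x a b c d, Alt (T x) ![a, b, c, d] = - Alt (T x) ![a, c, b, d] :=
      fun x a b c d => by
        rw [Alt_swap (T x) (i := 1) (j := 2) (by decide) ![a, b, c, d], cons4_swap_mid]
    have zr : ∀ x a b c d, Alt (T x) ![a, b, c, d] = - Alt (T x) ![a, b, d, c] :=
      fun x a b c d => by
        rw [Alt_swap (T x) (i := 2) (j := 3) (by decide) ![a, b, c, d], cons4_swap_right]
    have hX1 : (fun x => s x • (1 : A) + form2 γ (B x)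
        + form4 γ (fun a b c d => Alt (T x) ![a, b, c, d])) ∈ S := by
      simpa only [h.form4_Alt] using hX
    -- Alternating commutators and anticommutators follow the parity of the degree, and each step
    -- contracts one index. The scalar drops out first. After four steps only the degree-four
    -- coefficient is left, multiplied by 8·6·4·2 = 384. No linear independence of the Clifford
    -- products is needed.
    have c1 : ∀ a, (fun x => (4 : ℝ) • (∑ c, B x a c • γ c)
        + (8 : ℝ) • form3 γ (fun c d e => Alt (T x) ![a, c, d, e])) ∈ S := fun a => by
      convert hcomm a _ hX1 using 1
      funext x
      have e1 := h.commutator_sum_g2 (hB x) a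
      have e2 := h.commutator_sum_g4 (zl x) (zm x) (zr x) a
      rw [form3, ← e2, ← e1]
      simp only [form2, form4, mul_add, add_mul, mul_smul_comm, smul_mul_assoc, mul_one, one_mul]
      abel
    have c2 : ∀ a b, (fun x => (8 * B x a b) • (1 : A)
        + (48 : ℝ) • form2 γ (fun d e => Alt (T x) ![a, b, d, e])) ∈ S := fun a b => by
      convert hanti b _ (c1 a) using 1
      funext x
      have e1 : γ b * (∑ c, B x a c • γ c) + (∑ c, B x a c • γ c) * γ b
          = (2 * B x a b) • (1 : A) := by
        simp only [Finset.mul_sum, Finset.sum_mul, ← Finset.sum_add_distrib, mul_smul_comm,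
          smul_mul_assoc, ← smul_add, h b _]
        rw [← sum_kron_mul b (B x a), Finset.mul_sum, Finset.sum_smul]
        exact Finset.sum_congr rfl fun c _ => by module
      have e2 := h.anticommutator_sum_g3 (Z := fun c d e => Alt (T x) ![a, c, d, e])
        (fun c d e => zm x a c d e) (fun c d e => zr x a c d e) b
      have e3 : ∀ P Q : A, γ b * ((4 : ℝ) • P + (8 : ℝ) • Q) + ((4 : ℝ) • P + (8 : ℝ) • Q) * γ b
          = (4 : ℝ) • (γ b * P + P * γ b) + (8 : ℝ) • (γ b * Q + Q * γ b) := fun P Q => by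
        simp only [mul_add, add_mul, mul_smul_comm, smul_mul_assoc]; module
      rw [e3, e1, form3, e2, form2]
      module
    have c3 : ∀ a b c, (fun x => (192 : ℝ) • ∑ e, Alt (T x) ![a, b, c, e] • γ e) ∈ S :=
      fun a b c => by
        convert hcomm c _ (c2 a b) using 1
        funext x
        have e1 := h.commutator_sum_g2 (Z := fun d e => Alt (T x) ![a, b, d, e])
          (fun d e => zr x a b d e) c
        have e3 : ∀ (r : ℝ) (Q : A), γ c * (r • (1 : A) + (48 : ℝ) • Q)
            - (r • (1 : A) + (48 : ℝ) • Q) * γ c = (48 : ℝ) • (γ c * Q - Q * γ c) := fun r Q => by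
          simp only [mul_add, add_mul, mul_smul_comm, smul_mul_assoc, mul_one, one_mul]; module
        rw [e3, form2, e1]
        module
    have c4 : ∀ a b c d, (fun x => (384 * Alt (T x) ![a, b, c, d]) • (1 : A)) ∈ S :=
      fun a b c d => by
        convert hanti d _ (c3 a b c) using 1
        funext x
        simp only [Finset.mul_sum, Finset.sum_mul, ← Finset.sum_add_distrib, mul_smul_comm,
          smul_mul_assoc, ← smul_add, h d _]
        rw [← sum_kron_mul d fun e => Alt (T x) ![a, b, c, e], Finset.mul_sum, Finset.sum_smul,
          Finset.smul_sum]
        exact Finset.sum_congr rfl fun c _ => by module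
    have ht : ∀ k, (fun x => Alt (T x) k • (1 : A)) ∈ S := fun k => by
      have := hdiv _ _ (by norm_num) (c4 (k 0) (k 1) (k 2) (k 3))
      rwa [show ![k 0, k 1, k 2, k 3] = k by ext i; fin_cases i <;> rfl] at this
    -- After two contractions the two-form coefficient stands as a scalar next to a two-form built
    -- from the degree-four coefficients, which are already known to be admissible and can be
    -- subtracted.
    have hb : ∀ a b, (fun x => B x a b • (1 : A)) ∈ S := fun a b => by
      refine hdiv _ 8 (by norm_num) ?_
      have : (fun x => (48 : ℝ) • form2 γ (fun d e => Alt (T x) ![a, b, d, e])) ∈ S :=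
        S.smul_mem _ (hsum _ fun a => hsum _ fun b => hsm _ _ (ht _))
      convert S.sub_mem (c2 a b) this using 1
      funext x; simp
    refine ⟨?_, hb, ht⟩
    -- Contraction annihilates the scalar part, so it is obtained by subtracting the other two.
    convert S.sub_mem (S.sub_mem hX (hB' hb)) (hT' ht) using 1
    funext x
    simp only [Pi.sub_apply]
    abel
  · rintro ⟨h1, h2, h3⟩
    exact S.add_mem (S.add_mem h1 (hB' h2)) (hT' h3)

end Gamma

open Gamma

/-! ### The integrand as a sesquilinear expression in values and derivatives -/

section HermitianModules

variable {n : ℕ} {V : Type*} [NormedAddCommGroup V] [InnerProductSpace ℂ V]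

theorem CliffordModule.rel (R : CliffordModule n V) : Rel R.gam := by
  intro j k
  rw [R.gam_anticomm]
  split_ifs with hjk
  · simp only [kron, hjk, if_true, mul_one]
    rw [ofNat_smul_eq_nsmul]; simp
  · simp [kron, hjk]

theorem CliffordModule.inner_gam_left (R : CliffordModule n V) (k : Fin n) (p q : V) :
    inner ℂ (R.gam k p) q = inner ℂ p (R.gam k q) :=
  R.symm (stdVec k) p q

theorem inner_real_smul_left (r : ℝ) (p q : V) : inner ℂ (r • p) q = (r : ℂ) * inner ℂ p q := by
  rw [← Complex.coe_smul, inner_smul_left, Complex.conj_ofReal]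

theorem inner_real_smul_right (r : ℝ) (p q : V) : inner ℂ p (r • q) = (r : ℂ) * inner ℂ p q := by
  rw [← Complex.coe_smul, inner_smul_right]

theorem CliffordModule.inner_g2_left (R : CliffordModule n V) (c d : Fin n) (p q : V) :
    inner ℂ (g2 R.gam c d p) q = inner ℂ p (g2 R.gam d c q) := by
  simp only [g2, LinearMap.sub_apply, Module.End.mul_apply, LinearMap.smul_apply,
    Module.End.one_apply, inner_sub_left, inner_sub_right, R.inner_gam_left, inner_real_smul_left,
    inner_real_smul_right, kron_comm c d]

theorem CliffordModule.inner_form2_left (R : CliffordModule n V) (F : Fin n → Fin n → ℝ) (p q : V) :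
    inner ℂ (form2 R.gam F p) q = - inner ℂ p (form2 R.gam F q) := by
  rw [← inner_neg_right, ← LinearMap.neg_apply, ← R.rel.form2_swap]
  unfold form2
  rw [Finset.sum_comm (f := fun a b => F b a • g2 R.gam a b)]
  simp only [LinearMap.sum_apply, sum_inner, inner_sum, LinearMap.smul_apply,
    inner_real_smul_left, inner_real_smul_right, R.inner_g2_left]

/-- The coefficient `e_c^μ e_d^ν γ^{[c} γ^{d]}`. -/
def coeffTwo (γ : Fin n → Module.End ℂ V) (E F : Fin n → ℝ) : Module.End ℂ V :=
  ∑ c, ∑ d, (E c * F d) • g2 γ c d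

/-- The coefficient `e_c^μ γ^{[c} γ^{d]} ω_{jkd} γʲ γᵏ`. -/
def coeffOne (γ : Fin n → Module.End ℂ V) (E : Fin n → ℝ) (W : Fin n → Fin n → Fin n → ℝ) :
    Module.End ℂ V :=
  ∑ c, ∑ d, E c • (g2 γ c d * form2 γ (fun j k => W j k d))

/-- The coefficient `ω_{abc} γᵃ γᵇ γ^{[c} γ^{d]} ω_{jkd} γʲ γᵏ`. -/
def coeffZero (γ : Fin n → Module.End ℂ V) (W : Fin n → Fin n → Fin n → ℝ) : Module.End ℂ V :=
  ∑ c, ∑ d, form2 γ (fun j k => W j k c) * (g2 γ c d * form2 γ (fun j k => W j k d))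

/-- The factors of i cancel, and self-adjointness moves γᶜ to the right. The Kronecker part of γᶜγᵈ
is exactly the subtracted sum. -/
theorem CliffordModule.inner_dirac (R : CliffordModule n V) (N N' : Fin n → V) :
    inner ℂ (- Complex.I • ∑ c, R.gam c (N c)) (- Complex.I • ∑ c, R.gam c (N' c))
      - ∑ c, inner ℂ (N c) (N' c) = ∑ c, ∑ d, inner ℂ (N c) (g2 R.gam c d (N' d)) := by
  have h1 : inner ℂ (- Complex.I • ∑ c, R.gam c (N c)) (- Complex.I • ∑ c, R.gam c (N' c))
      = ∑ c, ∑ d, inner ℂ (N c) (R.gam c (R.gam d (N' d))) := by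
    rw [inner_smul_left, inner_smul_right, ← mul_assoc]
    simp only [map_neg, Complex.conj_I, neg_neg, mul_neg, Complex.I_mul_I, one_mul, sum_inner,
      inner_sum, R.inner_gam_left]
    rw [Finset.sum_comm]
  have h2 : ∀ c, inner ℂ (N c) (N' c)
      = ∑ d, kron c d • inner ℂ (N c) (N' d) := fun c => by rw [sum_kron_smul]
  rw [h1]
  simp only [h2, ← Finset.sum_sub_distrib]
  refine Finset.sum_congr rfl fun c _ => Finset.sum_congr rfl fun d _ => ?_
  simp only [g2, LinearMap.sub_apply, Module.End.mul_apply, LinearMap.smul_apply,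
    Module.End.one_apply, inner_sub_right, inner_real_smul_right, Complex.real_smul]

/-- A commutator of Clifford matrices is twice their antisymmetrized product, whence 1/8 becomes
1/4. -/
theorem spin_term (R : CliffordModule n V) (F : Fin n → Fin n → ℝ) (u : V) :
    (1 / 8 : ℝ) • ∑ j, ∑ k, F j k • (R.gam j * R.gam k - R.gam k * R.gam j) u
      = (1 / 4 : ℝ) • form2 R.gam F u := by
  have h : ∑ j, ∑ k, F j k • (R.gam j * R.gam k - R.gam k * R.gam j) u
      = (2 : ℝ) • form2 R.gam F u := by
    have h1 : ∀ j k, (R.gam j * R.gam k - R.gam k * R.gam j) = (2 : ℝ) • g2 R.gam j k :=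
      fun j k => by
        rw [R.rel.mul_swap k j, g2, kron_comm k j]; module
    simp only [h1, form2, LinearMap.sum_apply, LinearMap.smul_apply, Finset.smul_sum]
    exact Finset.sum_congr rfl fun j _ => Finset.sum_congr rfl fun k _ => by module
  rw [h]; module

/-- The adjoint of γ^{[c}γ^{d]} is γ^{[d}γ^{c]}, so both mixed terms carry the same coefficient,
acting on different arguments. The two-forms of the connection are skew-adjoint, which produces the
minus sign before 1/16. -/
theorem CliffordModule.inner_g2_expand (R : CliffordModule n V) (E : Fin n → Fin n → ℝ)
    (W : Fin n → Fin n → Fin n → ℝ) (p q : Fin n → V) (u v : V) :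
    ∑ c, ∑ d, inner ℂ ((∑ m, E c m • p m) + (1 / 4 : ℝ) • form2 R.gam (fun j k => W j k c) u)
        (g2 R.gam c d ((∑ m, E d m • q m) + (1 / 4 : ℝ) • form2 R.gam (fun j k => W j k d) v)) =
      (∑ m, ∑ l, inner ℂ (p m) (coeffTwo R.gam (fun c => E c m) (fun d => E d l) (q l)))
      + (1 / 4 : ℂ) * (∑ m, inner ℂ (p m) (coeffOne R.gam (fun c => E c m) W v))
      + (1 / 4 : ℂ) * (∑ m, inner ℂ (coeffOne R.gam (fun c => E c m) W u) (q m))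
      - (1 / 16 : ℂ) * inner ℂ u (coeffZero R.gam W v) := by
  have h1 : ∑ m, ∑ l, inner ℂ (p m) (coeffTwo R.gam (fun c => E c m) (fun d => E d l) (q l))
      = ∑ c, ∑ d, inner ℂ (∑ m, E c m • p m) (g2 R.gam c d (∑ m, E d m • q m)) := by
    simp only [coeffTwo, LinearMap.sum_apply, inner_sum, sum_inner, LinearMap.smul_apply, map_sum,
      inner_real_smul_left, inner_real_smul_right, LinearMap.map_smul_of_tower, Complex.ofReal_mul]
    rw [sum_rotate]
    refine Finset.sum_congr rfl fun c _ => ?_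
    rw [sum_rotate]
    refine Finset.sum_congr rfl fun d _ => ?_
    rw [Finset.sum_comm]
    exact Finset.sum_congr rfl fun l _ => Finset.sum_congr rfl fun m _ => by ring
  have h2 : ∑ m, inner ℂ (p m) (coeffOne R.gam (fun c => E c m) W v)
      = ∑ c, ∑ d, inner ℂ (∑ m, E c m • p m) (g2 R.gam c d (form2 R.gam (fun j k => W j k d) v)) := by
    simp only [coeffOne, LinearMap.sum_apply, inner_sum, sum_inner, LinearMap.smul_apply,
      inner_real_smul_left, inner_real_smul_right, Module.End.mul_apply]
    rw [Finset.sum_comm]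
    exact Finset.sum_congr rfl fun c _ => Finset.sum_comm
  have h3 : ∑ m, inner ℂ (coeffOne R.gam (fun c => E c m) W u) (q m)
      = ∑ c, ∑ d, inner ℂ (form2 R.gam (fun j k => W j k c) u) (g2 R.gam c d (∑ m, E d m • q m)) := by
    simp only [coeffOne, LinearMap.sum_apply, inner_sum, sum_inner, LinearMap.smul_apply, map_sum,
      inner_real_smul_left, inner_real_smul_right, Module.End.mul_apply, R.inner_g2_left,
      LinearMap.map_smul_of_tower]
    rw [sum_rotate]
    exact Finset.sum_congr rfl fun c _ => Finset.sum_comm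
  have h4 : inner ℂ u (coeffZero R.gam W v) = - ∑ c, ∑ d,
      inner ℂ (form2 R.gam (fun j k => W j k c) u)
        (g2 R.gam c d (form2 R.gam (fun j k => W j k d) v)) := by
    simp only [coeffZero, LinearMap.sum_apply, inner_sum, Module.End.mul_apply,
      R.inner_form2_left, Finset.sum_neg_distrib, neg_neg]
  rw [h1, h2, h3, h4]
  simp only [mul_neg, sub_neg_eq_add, Finset.mul_sum, ← Finset.sum_add_distrib]
  refine Finset.sum_congr rfl fun c _ => Finset.sum_congr rfl fun d _ => ?_
  simp only [inner_add_left, map_add, inner_add_right, LinearMap.map_smul_of_tower,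
    inner_real_smul_left, inner_real_smul_right]
  push_cast
  ring

end HermitianModules

/-! ### Operator-valued functions with locally integrable matrix elements -/

section LocalIntegrability

variable {M : Type*} [TopologicalSpace M] [MeasurableSpace M]
  {V : Type*} [NormedAddCommGroup V] [InnerProductSpace ℂ V]

theorem integrableAtFilter_fun_zero {μ : Measure M} {x₀ : M} :
    IntegrableAtFilter (fun _ : M => (0 : ℂ)) (𝓝 x₀) μ := integrableAtFilter_zero

theorem integrableAtFilter_const_mul {μ : Measure M} {x₀ : M} {f : M → ℂ}
    (hf : IntegrableAtFilter f (𝓝 x₀) μ) (c : ℂ) :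
    IntegrableAtFilter (fun x => c * f x) (𝓝 x₀) μ := hf.smul c

theorem integrableAtFilter_sum {μ : Measure M} {x₀ : M} {κ : Type*} (s : Finset κ) {f : κ → M → ℂ}
    (hf : ∀ k ∈ s, IntegrableAtFilter (f k) (𝓝 x₀) μ) :
    IntegrableAtFilter (fun x => ∑ k ∈ s, f k x) (𝓝 x₀) μ := by
  classical
  induction s using Finset.induction_on with
  | empty => simpa only [Finset.sum_empty] using integrableAtFilter_fun_zero
  | insert a s ha ih =>
    simp only [Finset.sum_insert ha]
    exact (hf a (by simp)).add (ih fun k hk => hf k (by simp [hk]))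

theorem integrableAtFilter_of_ae_eq [OpensMeasurableSpace M] {μ : Measure M} {x₀ : M}
    {f g : M → ℂ} {U : Set M} (hU : U ∈ 𝓝 x₀) (hf : IntegrableAtFilter f (𝓝 x₀) μ)
    (h : ∀ᵐ x ∂μ, x ∈ U → f x = g x) : IntegrableAtFilter g (𝓝 x₀) μ := by
  obtain ⟨s, hs, hfs⟩ := hf
  obtain ⟨N, hN, hNo, hxN⟩ := mem_nhds_iff.1 (Filter.inter_mem hs hU)
  refine ⟨N, hNo.mem_nhds hxN, (hfs.mono_set fun x hx => (hN hx).1).congr_fun_ae ?_⟩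
  rw [Filter.EventuallyEq, ae_restrict_iff' hNo.measurableSet]
  filter_upwards [h] with x hx hxN'
  exact hx (hN hxN').2

theorem integrableAtFilter_mul_continuousOn [BorelSpace M] {μ : Measure M} {x₀ : M}
    {f g : M → ℂ} {U : Set M} (hU : IsOpen U) (hx : x₀ ∈ U) (hg : ContinuousOn g U)
    (hf : IntegrableAtFilter f (𝓝 x₀) μ) :
    IntegrableAtFilter (fun x => g x * f x) (𝓝 x₀) μ := by
  obtain ⟨s, hs, hfs⟩ := hf
  have hb : ∀ᶠ x in 𝓝 x₀, ‖g x‖ < ‖g x₀‖ + 1 :=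
    (hg.continuousAt (hU.mem_nhds hx)).norm.eventually (gt_mem_nhds (by linarith))
  obtain ⟨N, hN, hNo, hxN⟩ := mem_nhds_iff.1
    (Filter.inter_mem (Filter.inter_mem hs (hU.mem_nhds hx)) hb)
  refine ⟨N, hNo.mem_nhds hxN, ?_⟩
  refine Integrable.bdd_mul (c := ‖g x₀‖ + 1) (hfs.mono_set fun x hx => (hN hx).1.1)
    ((hg.mono fun x hx => (hN hx).1.2).aestronglyMeasurable hNo.measurableSet) ?_
  rw [ae_restrict_iff' hNo.measurableSet]
  exact Filter.Eventually.of_forall fun x hx => (hN hx).2.le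

/-- The operator-valued functions whose matrix elements are integrable near `x₀`. -/
def locInt (V : Type*) [NormedAddCommGroup V] [InnerProductSpace ℂ V] (μ : Measure M) (x₀ : M) :
    Submodule ℝ (M → Module.End ℂ V) where
  carrier := {X | ∀ p q, IntegrableAtFilter (fun x => inner ℂ p (X x q)) (𝓝 x₀) μ}
  zero_mem' p q := by
    simpa only [Pi.zero_apply, LinearMap.zero_apply, inner_zero_right] using
      integrableAtFilter_fun_zero
  add_mem' {X Y} hX hY p q := by
    simp only [Pi.add_apply, LinearMap.add_apply, inner_add_right]
    exact (hX p q).add (hY p q)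
  smul_mem' r X hX p q := by
    simpa only [Pi.smul_apply, LinearMap.smul_apply, inner_real_smul_right] using
      integrableAtFilter_const_mul (hX p q) (r : ℂ)

theorem locInt_mul_left [FiniteDimensional ℂ V] {μ : Measure M} {x₀ : M} (a : Module.End ℂ V)
    (X : M → Module.End ℂ V) (hX : X ∈ locInt V μ x₀) : (fun x => a * X x) ∈ locInt V μ x₀ := by
  intro p q
  simpa only [Module.End.mul_apply, LinearMap.adjoint_inner_left] using
    hX (LinearMap.adjoint a p) q

theorem locInt_mul_right {μ : Measure M} {x₀ : M} (a : Module.End ℂ V)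
    (X : M → Module.End ℂ V) (hX : X ∈ locInt V μ x₀) : (fun x => X x * a) ∈ locInt V μ x₀ :=
  fun p q => hX p (a q)

theorem smul_one_mem_locInt_iff [Nontrivial V] {μ : Measure M} {x₀ : M} {f : M → ℝ} :
    (fun x => f x • (1 : Module.End ℂ V)) ∈ locInt V μ x₀ ↔ IntegrableAtFilter f (𝓝 x₀) μ := by
  have e : ∀ (p q : V), (fun x => inner ℂ p ((f x • (1 : Module.End ℂ V)) q)) =
      fun x => (f x : ℂ) * inner ℂ p q := fun p q => by
    funext x
    rw [LinearMap.smul_apply, Module.End.one_apply, inner_real_smul_right]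
  constructor
  · intro h
    -- The module is nonzero, so it has a unit vector, whose diagonal matrix element is f itself.
    obtain ⟨v, hv⟩ := exists_norm_eq V (zero_le_one (α := ℝ))
    obtain ⟨s, hs, hi⟩ := h v v
    refine ⟨s, hs, ?_⟩
    rw [e] at hi
    have := hi.re
    simp only [inner_self_eq_norm_sq_to_K, hv] at this
    simpa [IntegrableOn] using this
  · rintro ⟨s, hs, hi⟩ p q
    rw [e]
    exact ⟨s, hs, (Integrable.ofReal hi).mul_const _⟩

/-- In an orthonormal basis this is a finite sum of integrable matrix elements times continuous,
hence locally bounded, functions. -/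
theorem locInt_inner_continuousOn [BorelSpace M] [FiniteDimensional ℂ V] {μ : Measure M} {x₀ : M}
    {X : M → Module.End ℂ V} (hX : X ∈ locInt V μ x₀) {U : Set M} (hU : IsOpen U) (hx : x₀ ∈ U)
    {p q : M → V} (hp : ContinuousOn p U) (hq : ContinuousOn q U) :
    IntegrableAtFilter (fun x => inner ℂ (p x) (X x (q x))) (𝓝 x₀) μ := by
  let b := stdOrthonormalBasis ℂ V
  have e : (fun x => inner ℂ (p x) (X x (q x))) = fun x => ∑ k, ∑ l,
      (inner ℂ (p x) (b k) * inner ℂ (b l) (q x)) * inner ℂ (b k) (X x (b l)) := by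
    funext x
    rw [← b.sum_inner_mul_inner]
    refine Finset.sum_congr rfl fun k _ => ?_
    conv_lhs => rw [← b.sum_repr' (q x)]
    simp only [map_sum, map_smul, inner_sum, inner_smul_right, Finset.mul_sum]
    exact Finset.sum_congr rfl fun l _ => by ring
  rw [e]
  refine integrableAtFilter_sum _ fun k _ => integrableAtFilter_sum _ fun l _ =>
    integrableAtFilter_mul_continuousOn hU hx ?_ (hX _ _)
  exact (hp.inner continuousOn_const).mul (continuousOn_const.inner hq)

theorem locInt_inner_continuousOn_left [BorelSpace M] [FiniteDimensional ℂ V] {μ : Measure M}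
    {x₀ : M} {X : M → Module.End ℂ V} (hX : X ∈ locInt V μ x₀) {U : Set M} (hU : IsOpen U)
    (hx : x₀ ∈ U) {p q : M → V} (hp : ContinuousOn p U) (hq : ContinuousOn q U) :
    IntegrableAtFilter (fun x => inner ℂ (X x (p x)) (q x)) (𝓝 x₀) μ := by
  obtain ⟨s, hs, hi⟩ := locInt_inner_continuousOn hX hU hx hq hp
  refine ⟨s, hs, ?_⟩
  have h := (RCLike.conjLIE (K := ℂ)).toContinuousLinearEquiv.toContinuousLinearMap.integrable_comp hi
  simpa [IntegrableOn, inner_conj_symm] using h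

theorem locInt_congr [OpensMeasurableSpace M] {μ : Measure M} {x₀ : M}
    {X Y : M → Module.End ℂ V} (h : X =ᶠ[𝓝 x₀] Y) : X ∈ locInt V μ x₀ ↔ Y ∈ locInt V μ x₀ :=
  forall₂_congr fun p q =>
    ⟨fun hX => integrableAtFilter_of_ae_eq h hX
      (Filter.Eventually.of_forall fun x hx => by rw [show X x = Y x from hx]),
     fun hY => integrableAtFilter_of_ae_eq h hY
      (Filter.Eventually.of_forall fun x hx => by rw [show X x = Y x from hx])⟩

theorem locallyIntegrableOn_iff_of_isOpen {μ : Measure M} {f : M → ℝ} {U : Set M} (hU : IsOpen U) :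
    LocallyIntegrableOn f U μ ↔ ∀ x ∈ U, IntegrableAtFilter f (𝓝 x) μ := by
  refine forall₂_congr fun x hx => ?_
  rw [hU.nhdsWithin_eq hx]

end LocalIntegrability

/-! ### Derivatives in coordinates -/

section Coordinates

variable {n : ℕ} {M : Type*} [TopologicalSpace M]
  {V : Type*} [NormedAddCommGroup V] [NormedSpace ℝ V]

/-- The partial derivative `∂_μ s` in the chart `φ`, as a function on the manifold. -/
def chartDeriv (φ : OpenPartialHomeomorph M (Euc n)) (s : M → V) (m : Fin n) (x : M) : V :=
  fderiv ℝ (fun y => s (φ.symm y)) (φ x) (stdVec m)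

theorem sum_apply_smul_stdVec (v : Euc n) : ∑ m, v m • (stdVec m : Euc n) = v := by
  have := (EuclideanSpace.basisFun (Fin n) ℝ).sum_repr v
  simpa [stdVec] using this

theorem chartDeriv_of_eventuallyEq {φ : OpenPartialHomeomorph M (Euc n)} {s : M → V} {h : Euc n → V}
    {x₀ : M} (hx : x₀ ∈ φ.source) (hs : s =ᶠ[𝓝 x₀] fun x => h (φ x)) (m : Fin n) :
    ∀ᶠ x in 𝓝 x₀, chartDeriv φ s m x = fderiv ℝ h (φ x) (stdVec m) := by
  filter_upwards [hs.eventually_nhds, φ.open_source.mem_nhds hx] with x hx1 hx2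
  unfold chartDeriv
  have h1 : Filter.Tendsto φ.symm (𝓝 (φ x)) (𝓝 x) := by
    have := φ.continuousAt_symm (φ.map_source hx2)
    rwa [ContinuousAt, φ.left_inv hx2] at this
  have : (fun y => s (φ.symm y)) =ᶠ[𝓝 (φ x)] h := by
    filter_upwards [h1.eventually hx1, φ.open_target.mem_nhds (φ.map_source hx2)] with y hy hy2
    rw [hy, φ.right_inv hy2]
  rw [this.fderiv_eq]

variable [ChartedSpace (Euc n) M]

theorem differentiableAt_comp_symm {φ : OpenPartialHomeomorph M (Euc n)}
    (hφ : φ ∈ IsManifold.maximalAtlas (𝓡 n) ∞ M) {s : M → V} {x : M} (hx : x ∈ φ.source)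
    (hs : MDifferentiableAt (𝓡 n) 𝓘(ℝ, V) s x) :
    DifferentiableAt ℝ (fun y => s (φ.symm y)) (φ x) := by
  rw [← mdifferentiableAt_iff_differentiableAt]
  have h2 : MDifferentiableAt (𝓡 n) (𝓡 n) φ.symm (φ x) :=
    ((contMDiffOn_symm_of_mem_maximalAtlas hφ).contMDiffAt
      (φ.open_target.mem_nhds (φ.map_source hx))).mdifferentiableAt (by simp)
  refine MDifferentiableAt.comp (φ x) (g := s) (f := φ.symm) (I' := 𝓡 n) ?_ h2
  rwa [φ.left_inv hx]

theorem mfderiv_eq_sum_chartDeriv {φ : OpenPartialHomeomorph M (Euc n)}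
    (hφ : φ ∈ IsManifold.maximalAtlas (𝓡 n) ∞ M) {s : M → V} {x : M} (hx : x ∈ φ.source)
    (hs : MDifferentiableAt (𝓡 n) 𝓘(ℝ, V) s x) (v : TangentSpace (𝓡 n) x) :
    (show V from mfderiv (𝓡 n) 𝓘(ℝ, V) s x v) = ∑ m, coordComp φ v m • chartDeriv φ s m x := by
  have h1 : MDifferentiableAt (𝓡 n) (𝓡 n) φ x :=
    ((contMDiffOn_of_mem_maximalAtlas hφ).contMDiffAt (φ.open_source.mem_nhds hx)).mdifferentiableAt
      (by simp)
  have h3 : MDifferentiableAt (𝓡 n) 𝓘(ℝ, V) (fun y => s (φ.symm y)) (φ x) :=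
    mdifferentiableAt_iff_differentiableAt.2 (differentiableAt_comp_symm hφ hx hs)
  have h4 : s =ᶠ[𝓝 x] (fun y => s (φ.symm y)) ∘ φ := by
    filter_upwards [φ.open_source.mem_nhds hx] with z hz
    simp [φ.left_inv hz]
  have h5 := h4.mfderiv_eq (I := 𝓡 n) (I' := 𝓘(ℝ, V))
  have h6 := mfderiv_comp x h3 h1
  rw [mfderiv_eq_fderiv] at h6
  have h7 : (show Euc n →L[ℝ] V from mfderiv (𝓡 n) 𝓘(ℝ, V) s x) =
    (fderiv ℝ (fun y => s (φ.symm y)) (φ x)).comp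
      (show Euc n →L[ℝ] Euc n from mfderiv (𝓡 n) (𝓡 n) φ x) := h5.trans h6
  have h8 := congrArg (fun L : Euc n →L[ℝ] V => L v) h7
  refine h8.trans ?_
  change fderiv ℝ (fun y => s (φ.symm y)) (φ x)
    ((show Euc n →L[ℝ] Euc n from mfderiv (𝓡 n) (𝓡 n) φ x) v) = _
  conv_lhs => rw [← sum_apply_smul_stdVec ((show Euc n →L[ℝ] Euc n from mfderiv (𝓡 n) (𝓡 n) φ x) v)]
  rw [map_sum]
  refine Finset.sum_congr rfl fun m _ => ?_
  rw [map_smul]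
  rfl

theorem continuousOn_chartDeriv {φ : OpenPartialHomeomorph M (Euc n)}
    (hφ : φ ∈ IsManifold.maximalAtlas (𝓡 n) ∞ M) {s : M → V} {U : Set M} (hU : IsOpen U)
    (hs : ContMDiffOn (𝓡 n) 𝓘(ℝ, V) ∞ s U) (m : Fin n) :
    ContinuousOn (chartDeriv φ s m) (U ∩ φ.source) := by
  have ho : IsOpen (φ.target ∩ φ.symm ⁻¹' U) := φ.symm.isOpen_inter_preimage hU
  have h1 : ContDiffOn ℝ ∞ (fun y => s (φ.symm y)) (φ.target ∩ φ.symm ⁻¹' U) := by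
    rw [← contMDiffOn_iff_contDiffOn]
    exact hs.comp ((contMDiffOn_symm_of_mem_maximalAtlas hφ).mono inter_subset_left)
      fun y hy => hy.2
  have h2 := h1.continuousOn_fderiv_of_isOpen ho (by simp)
  have h3 : ContinuousOn (fun x => fderiv ℝ (fun y => s (φ.symm y)) (φ x)) (U ∩ φ.source) :=
    h2.comp (φ.continuousOn.mono inter_subset_right) fun x hx =>
      ⟨φ.map_source hx.2, by simpa [φ.left_inv hx.2] using hx.1⟩
  exact h3.clm_apply continuousOn_const

/-- A smooth function with compact support in a given neighbourhood that agrees near the centre with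
a given smooth function of the coordinates. -/
theorem exists_smooth_extension [T2Space M] [IsManifold (𝓡 n) ∞ M]
    {φ : OpenPartialHomeomorph M (Euc n)}
    (hφ : φ ∈ IsManifold.maximalAtlas (𝓡 n) ∞ M) {x₀ : M} {U : Set M} (hU : U ∈ 𝓝 x₀)
    (hx : x₀ ∈ φ.source) {h : Euc n → V} (hh : ContDiff ℝ ∞ h) :
    ∃ s : M → V, ContMDiff (𝓡 n) 𝓘(ℝ, V) ∞ s ∧ HasCompactSupport s ∧ tsupport s ⊆ U ∧
      s =ᶠ[𝓝 x₀] fun x => h (φ x) := by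
  obtain ⟨χ, -, hχ⟩ := (SmoothBumpFunction.nhds_basis_tsupport (I := 𝓡 n) x₀).mem_iff.1
    (Filter.inter_mem hU (φ.open_source.mem_nhds hx))
  have hts : tsupport (fun x => χ x • h (φ x)) ⊆ tsupport χ := tsupport_smul_subset_left _ _
  refine ⟨fun x => χ x • h (φ x), ?_, χ.hasCompactSupport.smul_right, hts.trans (hχ.trans inter_subset_left), ?_⟩
  · refine contMDiff_of_tsupport fun x hx => ?_
    have hxs : x ∈ φ.source := (hχ (hts hx)).2
    have h1 : ContMDiffAt (𝓡 n) (𝓡 n) ∞ φ x :=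
      (contMDiffOn_of_mem_maximalAtlas hφ).contMDiffAt (φ.open_source.mem_nhds hxs)
    exact χ.contMDiffAt.smul (hh.contMDiff.contMDiffAt.comp x h1)
  · filter_upwards [χ.eventuallyEq_one] with x hx
    simp [hx]

end Coordinates

/-! ### The action of the spin group on spinors -/

section SpinGroup

variable {n : ℕ} {V : Type*} [NormedAddCommGroup V] [InnerProductSpace ℂ V]

/-- Vectors act by self-adjoint operators and taking adjoints reverses products, so the adjoint is
represented by the reversed element. -/
theorem CliffordModule.inner_rep_left (R : CliffordModule n V) (x : Cl n) (p q : V) :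
    inner ℂ (R.rep x p) q = inner ℂ p (R.rep (CliffordAlgebra.reverse x) q) := by
  induction x using CliffordAlgebra.induction generalizing p q with
  | algebraMap r =>
    rw [CliffordAlgebra.reverse.commutes, AlgHom.commutes, Module.algebraMap_end_apply,
      Module.algebraMap_end_apply, inner_real_smul_left, inner_real_smul_right]
  | ι v =>
    rw [CliffordAlgebra.reverse_ι]; exact R.symm v p q
  | mul a b ha hb =>
    rw [CliffordAlgebra.reverse.map_mul, map_mul, map_mul, Module.End.mul_apply,
      Module.End.mul_apply, ha, hb]
  | add a b ha hb =>
    simp only [map_add, LinearMap.add_apply, inner_add_left, inner_add_right, ha, hb]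

theorem CliffordModule.inner_rep_spin (R : CliffordModule n V) {g : Cl n}
    (hg : g ∈ spinGroup (euclidQ n)) (p q : V) : inner ℂ (R.rep g p) (R.rep g q) = inner ℂ p q := by
  -- The star is reversal composed with the grade involution, which fixes the even element g; thus
  -- reversal inverts g and g acts unitarily.
  have h1 : CliffordAlgebra.reverse g * g = 1 := by
    rw [← spinGroup.star_mul_self_of_mem hg, CliffordAlgebra.star_def, spinGroup.involute_eq hg]
  rw [R.inner_rep_left, ← Module.End.mul_apply, ← map_mul, h1, map_one, Module.End.one_apply]

theorem clVec_injective : Function.Injective (clVec : Euc n → Cl n) := by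
  intro u v huv
  have h1 : CliffordAlgebra.ι (euclidQ n) (u - v) = 0 := by
    rw [map_sub, sub_eq_zero]; exact huv
  have h2 := CliffordAlgebra.ι_sq_scalar (euclidQ n) (u - v)
  rw [h1, zero_mul, euclidQ_apply] at h2
  have h3 : ‖u - v‖ ^ 2 = 0 := (algebraMap ℝ (Cl n)).injective (by rw [← h2, map_zero])
  simpa [sub_eq_zero] using h3

/-- Applying the intertwining relation twice gives a² g = g b², where the squares are the scalars
|a|² and |b|²; then g is cancelled. -/
theorem norm_eq_of_clVec_mul {g : Cl n} (hg : g ∈ spinGroup (euclidQ n)) {a b : Euc n}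
    (h : clVec a * g = g * clVec b) : ‖a‖ = ‖b‖ := by
  have h2 : algebraMap ℝ (Cl n) (euclidQ n a) * g = algebraMap ℝ (Cl n) (euclidQ n b) * g := by
    rw [← CliffordAlgebra.ι_sq_scalar, mul_assoc, h, ← mul_assoc, h, mul_assoc,
      CliffordAlgebra.ι_sq_scalar, Algebra.commutes]
  have h3 : algebraMap ℝ (Cl n) (euclidQ n a) = algebraMap ℝ (Cl n) (euclidQ n b) := by
    have h4 := congrArg (fun z => z * star g) h2
    simpa only [mul_assoc, spinGroup.mul_star_self_of_mem hg, mul_one] using h4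
  have h5 := (algebraMap ℝ (Cl n)).injective h3
  rw [euclidQ_apply, euclidQ_apply] at h5
  exact (sq_eq_sq₀ (norm_nonneg _) (norm_nonneg _)).1 h5

theorem eq_of_clVec_mul {g : Cl n} (hg : g ∈ spinGroup (euclidQ n)) {a b : Euc n}
    (h : clVec a * g = clVec b * g) : a = b := by
  refine clVec_injective ?_
  have h4 := congrArg (fun z => z * star g) h
  simpa only [mul_assoc, spinGroup.mul_star_self_of_mem hg, mul_one] using h4

/-- The matrix identity `∑_c (O⁻¹ e_c)_a (O⁻¹ e_c)_b = δ_{ab}` for an isometry `O`. -/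
theorem sum_isometry_symm (O : Euc n ≃ₗᵢ[ℝ] Euc n) (a b : Fin n) :
    ∑ c, O.symm (stdVec c) a * O.symm (stdVec c) b = kron a b := by
  have h0 : ∀ (v : Euc n) (a : Fin n), v a = inner ℝ (stdVec a) v := fun v a => by
    simp [stdVec, EuclideanSpace.inner_single_left]
  have h1 : ∀ c a : Fin n, O.symm (stdVec c) a = O (stdVec a) c := fun c a => by
    rw [h0, h0, ← O.inner_map_map, O.apply_symm_apply, real_inner_comm]
  have h2 : ∑ c, O (stdVec a) c * O (stdVec b) c = inner ℝ (O (stdVec a)) (O (stdVec b)) := by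
    rw [PiLp.inner_apply]
    exact Finset.sum_congr rfl fun c _ => mul_comm _ _
  simp only [h1]
  rw [h2, O.inner_map_map, ← h0]
  simp [stdVec, kron]

end SpinGroup

/-! ### Invariance of the integrand under change of the local trivialization -/

section FiniteDimensional

variable {n : ℕ} {M : Type*} [TopologicalSpace M] [ChartedSpace (Euc n) M]
  {E : Type*} [NormedAddCommGroup E] [NormedSpace ℝ E] [FiniteDimensional ℝ E]

theorem contMDiffOn_of_forall_linear {f : M → E} {U : Set M}
    (h : ∀ L : E →ₗ[ℝ] ℝ, ContMDiffOn (𝓡 n) 𝓘(ℝ, ℝ) ∞ (fun x => L (f x)) U) :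
    ContMDiffOn (𝓡 n) 𝓘(ℝ, E) ∞ f U := by
  let b := Module.finBasis ℝ E
  let e : E ≃L[ℝ] (Fin (Module.finrank ℝ E) → ℝ) := b.equivFun.toContinuousLinearEquiv
  have h1 : ContMDiffOn (𝓡 n) 𝓘(ℝ, Fin (Module.finrank ℝ E) → ℝ) ∞ (fun x => e (f x)) U :=
    contMDiffOn_pi_space.2 fun k => h (b.coord k)
  have h2 := (e.symm : (Fin (Module.finrank ℝ E) → ℝ) →L[ℝ] E).contMDiff.comp_contMDiffOn h1 (n := ∞)
  refine h2.congr fun x _ => ?_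
  simp

theorem mfderiv_linear_comp {G : M → E} {x : M} (hG : MDifferentiableAt (𝓡 n) 𝓘(ℝ, E) G x)
    (L : E →ₗ[ℝ] ℝ) (v : TangentSpace (𝓡 n) x) :
    (show ℝ from mfderiv (𝓡 n) 𝓘(ℝ, ℝ) (fun z => L (G z)) x v) =
      L (show E from mfderiv (𝓡 n) 𝓘(ℝ, E) G x v) := by
  have h1 : MDifferentiableAt 𝓘(ℝ, E) 𝓘(ℝ, ℝ) L.toContinuousLinearMap (G x) :=
    L.toContinuousLinearMap.differentiableAt.mdifferentiableAt
  have h2 := mfderiv_comp x h1 hG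
  rw [mfderiv_eq_fderiv, ContinuousLinearMap.fderiv] at h2
  exact congrArg (fun A : Euc n →L[ℝ] ℝ => A v) h2

end FiniteDimensional

section ProductRule

variable {n : ℕ} {M : Type*} [TopologicalSpace M] [ChartedSpace (Euc n) M]
  {V : Type*} [NormedAddCommGroup V] [NormedSpace ℝ V]

/-- In the chart at x this is the Leibniz rule for the evaluation of a linear map on a vector. -/
theorem mfderiv_clm_apply [IsManifold (𝓡 n) ∞ M]
    {G : M → V →L[ℝ] V} {s t : M → V} {x : M}
    (hG : MDifferentiableAt (𝓡 n) 𝓘(ℝ, V →L[ℝ] V) G x) (hs : MDifferentiableAt (𝓡 n) 𝓘(ℝ, V) s x)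
    (ht : MDifferentiableAt (𝓡 n) 𝓘(ℝ, V) t x) (h : t =ᶠ[𝓝 x] fun z => G z (s z))
    (v : TangentSpace (𝓡 n) x) :
    (show V from mfderiv (𝓡 n) 𝓘(ℝ, V) t x v) =
      (show V →L[ℝ] V from mfderiv (𝓡 n) 𝓘(ℝ, V →L[ℝ] V) G x v) (s x)
        + G x (show V from mfderiv (𝓡 n) 𝓘(ℝ, V) s x v) := by
  let φ := chartAt (Euc n) x
  have hφ : φ ∈ IsManifold.maximalAtlas (𝓡 n) ∞ M := IsManifold.chart_mem_maximalAtlas x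
  have hx : x ∈ φ.source := mem_chart_source _ x
  rw [mfderiv_eq_sum_chartDeriv hφ hx hG, mfderiv_eq_sum_chartDeriv hφ hx hs,
    mfderiv_eq_sum_chartDeriv hφ hx ht, map_sum, sum_apply,
    ← Finset.sum_add_distrib]
  refine Finset.sum_congr rfl fun m _ => ?_
  rw [map_smul, smul_apply, ← smul_add]
  congr 1
  have h1 : Filter.Tendsto φ.symm (𝓝 (φ x)) (𝓝 x) := by
    have := φ.continuousAt_symm (φ.map_source hx)
    rwa [ContinuousAt, φ.left_inv hx] at this
  have h2 : (fun y => t (φ.symm y)) =ᶠ[𝓝 (φ x)] fun y => G (φ.symm y) (s (φ.symm y)) :=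
    h1.eventually h
  have h3 := (differentiableAt_comp_symm hφ hx hG).hasFDerivAt.clm_apply
    (differentiableAt_comp_symm hφ hx hs).hasFDerivAt
  unfold chartDeriv
  rw [h2.fderiv_eq, h3.fderiv]
  simp only [φ.left_inv hx, add_apply, ContinuousLinearMap.comp_apply,
    ContinuousLinearMap.flip_apply]
  abel

end ProductRule

section Frames

variable {n : ℕ} {M : Type*} [TopologicalSpace M] [ChartedSpace (Euc n) M] {I : Type*}
  {P : SpinStructure n M I}

/-- The image of the transition function in the orthogonal group is read off from the reference
coframes, which are bijective at every point, whereas the coframes of the metric may degenerate. -/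
theorem SpinStructure.exists_isometry {i j : I} {x : M}
    (hx : x ∈ P.dom i ∩ P.dom j) : ∃ O : Euc n ≃ₗᵢ[ℝ] Euc n, ∀ u : Euc n,
      clVec (O u) * P.trans i j x = P.trans i j x * clVec u := by
  let ri := LinearEquiv.ofBijective (P.refCoframe i x).toLinearMap (P.refCoframe_bijective i x hx.1)
  let rj := LinearEquiv.ofBijective (P.refCoframe j x).toLinearMap (P.refCoframe_bijective j x hx.2)
  have h : ∀ u : Euc n, clVec ((rj.symm.trans ri) u) * P.trans i j x
      = P.trans i j x * clVec u := fun u => by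
    have h1 := P.refCoframe_trans i j x hx (rj.symm u)
    have h2 : P.refCoframe j x (rj.symm u) = u := rj.apply_symm_apply u
    rw [h2] at h1
    exact h1
  exact ⟨⟨rj.symm.trans ri, fun u => norm_eq_of_clVec_mul (P.trans_mem i j x hx) (h u)⟩, h⟩

theorem SingularMetric.frame_trans (e : SingularMetric P) {i j : I} {x : M}
    (hx : x ∈ P.dom i ∩ P.dom j) {O : Euc n ≃ₗᵢ[ℝ] Euc n}
    (hO : ∀ u : Euc n, clVec (O u) * P.trans i j x = P.trans i j x * clVec u) (c : Fin n) :
    e.frame i c x = ∑ a, O.symm (stdVec c) a • e.frame j a x := by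
  have h1 : e.cof i x = (O.toContinuousLinearEquiv : Euc n →L[ℝ] Euc n) ∘L e.cof j x := by
    ext1 v
    refine eq_of_clVec_mul (P.trans_mem i j x hx) ?_
    rw [e.cof_trans i j x hx]
    exact (hO _).symm
  have h2 : e.frame i c x = (e.cof j x).inverse (O.symm (stdVec c)) := by
    unfold SingularMetric.frame
    -- This also holds where the coframe is not invertible: both inverses are then zero by default,
    -- so frames transform correctly at every point.
    rw [h1, ContinuousLinearMap.inverse_equiv_comp]
    rfl
  rw [h2]
  conv_lhs => rw [← sum_apply_smul_stdVec (O.symm (stdVec c))]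
  rw [map_sum]
  exact Finset.sum_congr rfl fun a _ => map_smul _ _ _

/-- The map `w ↦ (1/8) w_{jk} [γʲ, γᵏ]` as a linear map. -/
def spinLiftHom (n : ℕ) : Matrix (Fin n) (Fin n) ℝ →ₗ[ℝ] Cl n where
  toFun := spinLift
  map_add' v w := by
    simp only [spinLift, Matrix.add_apply, add_smul, Finset.sum_add_distrib, smul_add]
  map_smul' r v := by
    simp only [spinLift, Matrix.smul_apply, smul_eq_mul, mul_smul, ← Finset.smul_sum,
      smul_comm r (1 / 8 : ℝ), RingHom.id_apply]

theorem CliffordModule.rep_spinLift {V : Type*} [NormedAddCommGroup V] [InnerProductSpace ℂ V]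
    (R : CliffordModule n V) (w : Matrix (Fin n) (Fin n) ℝ) (p : V) :
    R.rep (spinLift w) p = (1 / 8 : ℝ) • ∑ j, ∑ k, w j k •
      (R.gam j * R.gam k - R.gam k * R.gam j) p := by
  simp only [spinLift, map_smul, map_sum, map_sub, map_mul, LinearMap.smul_apply,
    LinearMap.sum_apply]
  rfl

end Frames

section Gauge

variable {n : ℕ} {M : Type*} [TopologicalSpace M] [ChartedSpace (Euc n) M] {I : Type*}
  {V : Type*} [NormedAddCommGroup V] [InnerProductSpace ℂ V]

section Representation

variable [FiniteDimensional ℂ V]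

/-- The representation of the Clifford algebra by continuous real-linear maps. -/
def CliffordModule.repL (R : CliffordModule n V) : Cl n →ₗ[ℝ] (V →L[ℝ] V) :=
  haveI := FiniteDimensional.complexToReal V
  LinearMap.toContinuousLinearMap.toLinearMap ∘ₗ
    { toFun := fun x => (R.rep x).restrictScalars ℝ
      map_add' := fun x y => by ext; simp
      map_smul' := fun r x => by ext; simp }

theorem CliffordModule.repL_apply (R : CliffordModule n V) (x : Cl n) (p : V) :
    R.repL x p = R.rep x p := rfl

theorem SpinStructure.contMDiffOn_repL_trans (P : SpinStructure n M I) (R : CliffordModule n V)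
    (i j : I) : ContMDiffOn (𝓡 n) 𝓘(ℝ, V →L[ℝ] V) ∞ (fun x => R.repL (P.trans i j x))
      (P.dom i ∩ P.dom j) :=
  haveI := FiniteDimensional.complexToReal V
  contMDiffOn_of_forall_linear fun L => P.trans_smooth i j (L ∘ₗ R.repL)

end Representation

variable [IsManifold (𝓡 n) ∞ M] [SecondCountableTopology M] [MeasurableSpace M] [BorelSpace M]
  {P : SpinStructure n M I} {e : SingularMetric P} {R : CliffordModule n V}

/-- The covariant derivative along a tangent vector, in the local trivialization `i`. -/
def covDeriv (w : LeviCivita e) (f : SpinorField P R) (i : I) (x : M) :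
    TangentSpace (𝓡 n) x →ₗ[ℝ] V :=
  (show TangentSpace (𝓡 n) x →L[ℝ] V from mfderiv (𝓡 n) 𝓘(ℝ, V) (f.val i) x).toLinearMap +
    (LinearMap.applyₗ (f.val i x)).restrictScalars ℝ ∘ₗ R.rep.toLinearMap ∘ₗ spinLiftHom n ∘ₗ
      w.form i x

theorem nabla_eq_covDeriv (w : LeviCivita e) (f : SpinorField P R) (i : I) (c : Fin n) (x : M) :
    nabla w f i c x = covDeriv w f i x (e.frame i c x) := by
  have h : covDeriv w f i x (e.frame i c x) =
      (show V from mfderiv (𝓡 n) 𝓘(ℝ, V) (f.val i) x (e.frame i c x))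
        + R.rep (spinLift (w.form i x (e.frame i c x))) (f.val i x) := rfl
  rw [h, R.rep_spinLift]
  rfl

variable [FiniteDimensional ℂ V]

/-- The covariant derivatives in two local trivializations are related by the transition function
wherever the connection forms satisfy the transformation law of a connection. -/
theorem covDeriv_trans (w : LeviCivita e) (f : SpinorField P R) {i j : I} {x : M}
    (hx : x ∈ P.dom i ∩ P.dom j)
    (hg : ∀ (v : TangentSpace (𝓡 n) x) (L : Cl n →ₗ[ℝ] ℝ),
      L (spinLift (w.form i x v) * P.trans i j x) = L (P.trans i j x * spinLift (w.form j x v))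
        - (show ℝ from mfderiv (𝓡 n) 𝓘(ℝ, ℝ) (fun z => L (P.trans i j z)) x v))
    (v : TangentSpace (𝓡 n) x) :
    covDeriv w f i x v = R.rep (P.trans i j x) (covDeriv w f j x v) := by
  have := FiniteDimensional.complexToReal V
  have ho : P.dom i ∩ P.dom j ∈ 𝓝 x := ((P.isOpen_dom i).inter (P.isOpen_dom j)).mem_nhds hx
  have hG : MDifferentiableAt (𝓡 n) 𝓘(ℝ, V →L[ℝ] V) (fun z => R.repL (P.trans i j z)) x :=
    ((P.contMDiffOn_repL_trans R i j).contMDiffAt ho).mdifferentiableAt (by simp)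
  have hs : ∀ k, x ∈ P.dom k → MDifferentiableAt (𝓡 n) 𝓘(ℝ, V) (f.val k) x := fun k hk =>
    ((f.smooth k).contMDiffAt ((P.isOpen_dom k).mem_nhds hk)).mdifferentiableAt (by simp)
  have h1 := mfderiv_clm_apply hG (hs j hx.2) (hs i hx.1)
    (by filter_upwards [ho] with z hz using f.val_trans i j z hz) v
  have h2 : (show V →L[ℝ] V from
      mfderiv (𝓡 n) 𝓘(ℝ, V →L[ℝ] V) (fun z => R.repL (P.trans i j z)) x v) =
      R.repL (P.trans i j x * spinLift (w.form j x v))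
        - R.repL (spinLift (w.form i x v) * P.trans i j x) := by
    -- The gauge law is tested by functionals on the Clifford algebra. Pulling functionals on
    -- operators back along the representation yields the operator identity dG = G A_j - A_i G.
    rw [← sub_eq_zero, ← Module.forall_dual_apply_eq_zero_iff ℝ]
    intro L
    have h3 := hg v (L ∘ₗ R.repL)
    have h4 := mfderiv_linear_comp hG L v
    simp only [LinearMap.comp_apply] at h3
    have key : ∀ a b d : ℝ, b = a - d → d - (a - b) = 0 := fun a b d h => by linarith
    rw [map_sub, map_sub, ← h4]
    exact key _ _ _ h3
  have hc : ∀ k, covDeriv w f k x v = (show V from mfderiv (𝓡 n) 𝓘(ℝ, V) (f.val k) x v)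
      + R.rep (spinLift (w.form k x v)) (f.val k x) := fun k => rfl
  rw [hc, hc, h1, h2, f.val_trans i j x hx]
  generalize (show V from mfderiv (𝓡 n) 𝓘(ℝ, V) (f.val j) x v) = D
  simp only [sub_apply, R.repL_apply, map_mul, Module.End.mul_apply, map_add]
  abel

/-- The transition function g acts unitarily on spinors, while the frame index of ∇ is rotated by an
orthogonal matrix Q, with γ_c g = g ∑_b Q_{cb} γ_b. In both D and the norm of ∇ the two factors of Q
contract to the identity. -/
theorem lichIntegrand_trans (w : LeviCivita e) (f h : SpinorField P R) {i j : I} {x : M}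
    (hx : x ∈ P.dom i ∩ P.dom j)
    (hg : ∀ (v : TangentSpace (𝓡 n) x) (L : Cl n →ₗ[ℝ] ℝ),
      L (spinLift (w.form i x v) * P.trans i j x) = L (P.trans i j x * spinLift (w.form j x v))
        - (show ℝ from mfderiv (𝓡 n) 𝓘(ℝ, ℝ) (fun z => L (P.trans i j z)) x v)) :
    lichIntegrand w f h i x = lichIntegrand w f h j x := by
  obtain ⟨O, hO⟩ := SpinStructure.exists_isometry hx
  set Q : Fin n → Fin n → ℝ := fun c a => O.symm (stdVec c) a with hQ
  set g := P.trans i j x with hgd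
  have hgm : g ∈ spinGroup (euclidQ n) := P.trans_mem i j x hx
  have hQQ : ∀ a b, ∑ c, Q c a * Q c b = kron a b := sum_isometry_symm O
  have hN : ∀ (f : SpinorField P R) (c : Fin n),
      nabla w f i c x = R.rep g (∑ a, Q c a • nabla w f j a x) := fun f c => by
    rw [nabla_eq_covDeriv, covDeriv_trans w f hx hg, e.frame_trans hx hO, map_sum]
    congr 1
    refine Finset.sum_congr rfl fun a _ => ?_
    rw [map_smul, nabla_eq_covDeriv]
  have hγ : ∀ c (p : V), R.gam c (R.rep g p) = R.rep g (∑ b, Q c b • R.gam b p) := fun c p => by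
    have h1 := hO (O.symm (stdVec c))
    rw [O.apply_symm_apply] at h1
    have h2 : R.rep (clVec (O.symm (stdVec c))) = ∑ b, Q c b • R.gam b := by
      conv_lhs => rw [← sum_apply_smul_stdVec (O.symm (stdVec c))]
      simp only [map_sum, map_smul]
      rfl
    rw [CliffordModule.gam, ← Module.End.mul_apply, ← map_mul, h1, map_mul, h2,
      Module.End.mul_apply]
    simp only [LinearMap.sum_apply, LinearMap.smul_apply]
  have hD : ∀ f : SpinorField P R, dirac w f i x = R.rep g (dirac w f j x) := fun f => by
    unfold dirac
    rw [map_smul]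
    congr 1
    simp only [hN, hγ, ← map_sum]
    congr 1
    have h1 : ∑ c, ∑ b, Q c b • R.gam b (∑ a, Q c a • nabla w f j a x)
        = ∑ b, ∑ a, (∑ c, Q c b * Q c a) • R.gam b (nabla w f j a x) := by
      rw [Finset.sum_comm]
      refine Finset.sum_congr rfl fun b _ => ?_
      simp only [map_sum, LinearMap.map_smul_of_tower, Finset.smul_sum, smul_smul, Finset.sum_smul]
      rw [Finset.sum_comm]
    rw [h1]
    simp only [hQQ, sum_kron_smul]
  have hI : ∑ c, inner ℂ (nabla w f i c x) (nabla w h i c x)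
      = ∑ c, inner ℂ (nabla w f j c x) (nabla w h j c x) := by
    simp only [hN, R.inner_rep_spin hgm, sum_inner, inner_sum, inner_real_smul_left,
      inner_real_smul_right]
    rw [← sum_rotate, Finset.sum_comm]
    refine Finset.sum_congr rfl fun a _ => ?_
    rw [← sum_kron_smul a fun b => inner ℂ (nabla w f j a x) (nabla w h j b x)]
    refine Finset.sum_congr rfl fun b _ => ?_
    rw [← hQQ, Complex.real_smul, Complex.ofReal_sum, Finset.sum_mul]
    refine Finset.sum_congr rfl fun c _ => ?_
    push_cast; ring
  rw [lichIntegrand, hI, hD, hD, R.inner_rep_spin hgm, lichIntegrand]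

end Gauge

/-! ### Test spinors supported in one trivialization -/

section TestSpinors

variable {n : ℕ} {M : Type*} [TopologicalSpace M] [ChartedSpace (Euc n) M] {I : Type*}
  {V : Type*} [NormedAddCommGroup V] [InnerProductSpace ℂ V] [FiniteDimensional ℂ V]

open Classical in
/-- The spinor field with given smooth representative in one local trivialization, supported in a
compact subset of its domain. -/
def SpinorField.ofLocal (P : SpinStructure n M I) (R : CliffordModule n V) (i : I) (s : M → V)
    (hs : ContMDiff (𝓡 n) 𝓘(ℝ, V) ∞ s) (hc : HasCompactSupport s) (hi : tsupport s ⊆ P.dom i) :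
    SpinorField P R where
  val j x := if x ∈ P.dom i then R.rep (P.trans j i x) (s x) else 0
  val_trans j k x hx := by
    split_ifs with h
    · rw [← Module.End.mul_apply, ← map_mul, P.trans_comp j k i x ⟨hx, h⟩]
    · simp
  smooth j x hx := by
    refine ContMDiffAt.contMDiffWithinAt ?_
    by_cases hxs : x ∈ tsupport s
    · have ho : P.dom j ∩ P.dom i ∈ 𝓝 x :=
        ((P.isOpen_dom j).inter (P.isOpen_dom i)).mem_nhds ⟨hx, hi hxs⟩
      have h1 := ((P.contMDiffOn_repL_trans R j i).contMDiffAt ho).clm_apply hs.contMDiffAt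
      refine h1.congr_of_eventuallyEq ?_
      filter_upwards [ho] with z hz
      rw [if_pos hz.2, R.repL_apply]
    · refine (contMDiffAt_const (c := (0 : V))).congr_of_eventuallyEq ?_
      filter_upwards [notMem_tsupport_iff_eventuallyEq.1 hxs] with z hz
      simp [hz]
  compact := ⟨tsupport s, hc, fun j x _ hx => by
    simp [image_eq_zero_of_notMem_tsupport hx]⟩

theorem SpinorField.ofLocal_val (P : SpinStructure n M I) (R : CliffordModule n V) (i : I)
    (s : M → V) (hs : ContMDiff (𝓡 n) 𝓘(ℝ, V) ∞ s) (hc : HasCompactSupport s)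
    (hi : tsupport s ⊆ P.dom i) {x : M} (hx : x ∈ P.dom i) :
    (SpinorField.ofLocal P R i s hs hc hi).val i x = s x := by
  simp only [SpinorField.ofLocal, if_pos hx, P.trans_self i x hx, map_one, Module.End.one_apply]

/-- These fields, with prescribed coordinate dependence near a point, probe the individual
coefficients of the integrand. -/
theorem exists_spinorField [T2Space M] [IsManifold (𝓡 n) ∞ M] (P : SpinStructure n M I)
    (R : CliffordModule n V) {i : I} {φ : OpenPartialHomeomorph M (Euc n)}
    (hφ : φ ∈ IsManifold.maximalAtlas (𝓡 n) ∞ M) {x₀ : M} (hx : x₀ ∈ P.dom i ∩ φ.source)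
    {h : Euc n → V} (hh : ContDiff ℝ ∞ h) :
    ∃ f : SpinorField P R, f.val i =ᶠ[𝓝 x₀] fun x => h (φ x) := by
  obtain ⟨s, hs, hc, hi, he⟩ := exists_smooth_extension hφ ((P.isOpen_dom i).mem_nhds hx.1) hx.2 hh
  refine ⟨.ofLocal P R i s hs hc hi, ?_⟩
  filter_upwards [he, (P.isOpen_dom i).mem_nhds hx.1] with x h1 h2
  rw [SpinorField.ofLocal_val P R i s hs hc hi h2, h1]

end TestSpinors

/-! ### Coefficients of the integrand in a chart and their integrability -/

section Coefficients

variable {n : ℕ} {M : Type*} [TopologicalSpace M] [ChartedSpace (Euc n) M] {I : Type*}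
  {V : Type*} [NormedAddCommGroup V] [InnerProductSpace ℂ V]
  [IsManifold (𝓡 n) ∞ M] [SecondCountableTopology M] [MeasurableSpace M] [BorelSpace M]
  {P : SpinStructure n M I} {e : SingularMetric P}

/-- The coefficient of `⟨∂_μ η, ∂_ν ψ⟩` in the integrand. -/
def secondCoeff (e : SingularMetric P) (R : CliffordModule n V) (i : I)
    (φ : OpenPartialHomeomorph M (Euc n)) (m l : Fin n) (x : M) : Module.End ℂ V :=
  coeffTwo R.gam (fun c => e.frameComp i φ c m x) (fun d => e.frameComp i φ d l x)

/-- The coefficient of `⟨∂_μ η, ψ⟩` in the integrand, up to a factor. -/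
def firstCoeff (w : LeviCivita e) (R : CliffordModule n V) (i : I)
    (φ : OpenPartialHomeomorph M (Euc n)) (m : Fin n) (x : M) : Module.End ℂ V :=
  coeffOne R.gam (fun c => e.frameComp i φ c m x) (fun a b c => w.comp i a b c x)

/-- The coefficient of `⟨η, ψ⟩` in the integrand, up to a factor. -/
def zerothCoeff (w : LeviCivita e) (R : CliffordModule n V) (i : I) (x : M) : Module.End ℂ V :=
  coeffZero R.gam (fun a b c => w.comp i a b c x)

theorem LeviCivita.comp_skew (w : LeviCivita e) {i : I} {x : M} (hx : x ∈ P.dom i)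
    (a b c : Fin n) : w.comp i a b c x = - w.comp i b a c x :=
  w.skew i x hx _ a b

theorem nabla_eq_chart {R : CliffordModule n V} (w : LeviCivita e) (f : SpinorField P R) {i : I}
    {φ : OpenPartialHomeomorph M (Euc n)} (hφ : φ ∈ IsManifold.maximalAtlas (𝓡 n) ∞ M) {x : M}
    (hx : x ∈ P.dom i ∩ φ.source) (c : Fin n) :
    nabla w f i c x = (∑ m, e.frameComp i φ c m x • chartDeriv φ (f.val i) m x)
      + (1 / 4 : ℝ) • form2 R.gam (fun j k => w.comp i j k c x) (f.val i x) := by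
  have hs : MDifferentiableAt (𝓡 n) 𝓘(ℝ, V) (f.val i) x :=
    ((f.smooth i).contMDiffAt ((P.isOpen_dom i).mem_nhds hx.1)).mdifferentiableAt (by simp)
  rw [← spin_term]
  exact congrArg₂ (· + ·) (mfderiv_eq_sum_chartDeriv hφ hx.2 hs _) rfl

theorem lichIntegrand_eq_chart {R : CliffordModule n V} (w : LeviCivita e) (f h : SpinorField P R)
    {i : I} {φ : OpenPartialHomeomorph M (Euc n)}
    (hφ : φ ∈ IsManifold.maximalAtlas (𝓡 n) ∞ M) {x : M} (hx : x ∈ P.dom i ∩ φ.source) :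
    lichIntegrand w f h i x =
      (∑ m, ∑ l, inner ℂ (chartDeriv φ (f.val i) m x)
        (secondCoeff e R i φ m l x (chartDeriv φ (h.val i) l x)))
      + (1 / 4 : ℂ) * (∑ m, inner ℂ (chartDeriv φ (f.val i) m x) (firstCoeff w R i φ m x (h.val i x)))
      + (1 / 4 : ℂ) * (∑ m, inner ℂ (firstCoeff w R i φ m x (f.val i x)) (chartDeriv φ (h.val i) m x))
      - (1 / 16 : ℂ) * inner ℂ (f.val i x) (zerothCoeff w R i x (h.val i x)) := by
  unfold lichIntegrand dirac
  rw [R.inner_dirac]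
  simp only [nabla_eq_chart w _ hφ hx]
  exact R.inner_g2_expand (fun c m => e.frameComp i φ c m x) (fun a b c => w.comp i a b c x) _ _ _ _

/-- The coefficients of the integrand are locally integrable near `x₀`. -/
def CoeffIntegrable (w : LeviCivita e) (R : CliffordModule n V) (i : I)
    (φ : OpenPartialHomeomorph M (Euc n)) (x₀ : M) : Prop :=
  (∀ m l, secondCoeff e R i φ m l ∈ locInt V e.dvol x₀) ∧
    (∀ m, firstCoeff w R i φ m ∈ locInt V e.dvol x₀) ∧ zerothCoeff w R i ∈ locInt V e.dvol x₀

variable [FiniteDimensional ℂ V]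

theorem CoeffIntegrable.integrableAtFilter {R : CliffordModule n V} {w : LeviCivita e} {i : I}
    {φ : OpenPartialHomeomorph M (Euc n)} (hφ : φ ∈ IsManifold.maximalAtlas (𝓡 n) ∞ M) {x₀ : M}
    (hx : x₀ ∈ P.dom i ∩ φ.source) (hw : CoeffIntegrable w R i φ x₀) (f h : SpinorField P R) :
    IntegrableAtFilter (lichIntegrand w f h i) (𝓝 x₀) e.dvol := by
  have ho : IsOpen (P.dom i ∩ φ.source) := (P.isOpen_dom i).inter φ.open_source
  have hv : ∀ f : SpinorField P R, ContinuousOn (f.val i) (P.dom i ∩ φ.source) := fun f =>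
    (f.smooth i).continuousOn.mono inter_subset_left
  have hd : ∀ (f : SpinorField P R) m, ContinuousOn (chartDeriv φ (f.val i) m)
      (P.dom i ∩ φ.source) := fun f m => continuousOn_chartDeriv hφ (P.isOpen_dom i) (f.smooth i) m
  refine integrableAtFilter_of_ae_eq (ho.mem_nhds hx) ?_ (Filter.Eventually.of_forall fun x hx =>
    (lichIntegrand_eq_chart w f h hφ hx).symm)
  refine ((IntegrableAtFilter.add ?_ (integrableAtFilter_const_mul ?_ _)).add
    (integrableAtFilter_const_mul ?_ _)).sub (integrableAtFilter_const_mul ?_ _)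
  · exact integrableAtFilter_sum _ fun m _ => integrableAtFilter_sum _ fun l _ =>
      locInt_inner_continuousOn (hw.1 m l) ho hx (hd f m) (hd h l)
  · exact integrableAtFilter_sum _ fun m _ =>
      locInt_inner_continuousOn (hw.2.1 m) ho hx (hd f m) (hv h)
  · exact integrableAtFilter_sum _ fun m _ =>
      locInt_inner_continuousOn_left (hw.2.1 m) ho hx (hv f) (hd h m)
  · exact locInt_inner_continuousOn hw.2.2 ho hx (hv f) (hv h)

/-- Constant spinors see only the zeroth-order coefficient. A linear η and a constant ψ add one
first-order coefficient, and two linear spinors add one second-order coefficient. At each stage the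
lower-order terms are already integrable and are removed. -/
theorem coeffIntegrable_of_forall [T2Space M] {R : CliffordModule n V} {w : LeviCivita e} {i : I}
    {φ : OpenPartialHomeomorph M (Euc n)} (hφ : φ ∈ IsManifold.maximalAtlas (𝓡 n) ∞ M) {x₀ : M}
    (hx : x₀ ∈ P.dom i ∩ φ.source)
    (H : ∀ f h : SpinorField P R, IntegrableAtFilter (lichIntegrand w f h i) (𝓝 x₀) e.dvol) :
    CoeffIntegrable w R i φ x₀ := by
  have ho : IsOpen (P.dom i ∩ φ.source) := (P.isOpen_dom i).inter φ.open_source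
  -- the integrand for spinors with prescribed dependence on the coordinates
  have key : ∀ f h : Euc n → V, ContDiff ℝ ∞ f → ContDiff ℝ ∞ h → IntegrableAtFilter (fun x =>
      (∑ m, ∑ l, inner ℂ (fderiv ℝ f (φ x) (stdVec m))
        (secondCoeff e R i φ m l x (fderiv ℝ h (φ x) (stdVec l))))
      + (1 / 4 : ℂ) * (∑ m, inner ℂ (fderiv ℝ f (φ x) (stdVec m)) (firstCoeff w R i φ m x (h (φ x))))
      + (1 / 4 : ℂ) * (∑ m, inner ℂ (firstCoeff w R i φ m x (f (φ x))) (fderiv ℝ h (φ x) (stdVec m)))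
      - (1 / 16 : ℂ) * inner ℂ (f (φ x)) (zerothCoeff w R i x (h (φ x)))) (𝓝 x₀) e.dvol := by
    intro f h hf hh
    obtain ⟨f', hf'⟩ := exists_spinorField P R hφ hx hf
    obtain ⟨h', hh'⟩ := exists_spinorField P R hφ hx hh
    have h1 := Filter.eventually_all.2 fun m => chartDeriv_of_eventuallyEq hx.2 hf' m
    have h2 := Filter.eventually_all.2 fun m => chartDeriv_of_eventuallyEq hx.2 hh' m
    have hU := ((h1.and h2).and (hf'.and hh')).and (ho.mem_nhds hx)
    refine integrableAtFilter_of_ae_eq hU (H f' h') (Filter.Eventually.of_forall ?_)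
    rintro x ⟨⟨⟨hx1, hx2⟩, hx3, hx4⟩, hx5⟩
    rw [lichIntegrand_eq_chart w f' h' hφ hx5]
    simp only [hx1, hx2, hx3, hx4]
  have hcφ : ∀ m, ContinuousOn (fun x => (φ x) m) (P.dom i ∩ φ.source) := fun m =>
    (EuclideanSpace.proj m : Euc n →L[ℝ] ℝ).continuous.comp_continuousOn
      (φ.continuousOn.mono inter_subset_right)
  let lin : Fin n → V → Euc n →L[ℝ] V := fun m p =>
    (EuclideanSpace.proj m : Euc n →L[ℝ] ℝ).smulRight p
  have hlin : ∀ m p y, lin m p y = y m • p := fun m p y => rfl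
  have hlin2 : ∀ m p k, lin m p (stdVec k) = kron m k • p := fun m p k => by
    rw [hlin]; congr 1
    simp [stdVec, kron]
  have hc : ∀ m (p : V), ContinuousOn (fun x => (φ x) m • p) (P.dom i ∩ φ.source) := fun m p =>
    (hcφ m).smul continuousOn_const
  have h0 : zerothCoeff w R i ∈ locInt V e.dvol x₀ := by
    intro p q
    have h1 := integrableAtFilter_const_mul
      (key (fun _ => p) (fun _ => q) contDiff_const contDiff_const) (-16)
    simp only [fderiv_fun_const, Pi.zero_apply, zero_apply, inner_zero_left,
      inner_zero_right, Finset.sum_const_zero, mul_zero, add_zero, zero_sub] at h1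
    convert h1 using 1
    funext x; ring
  have h1 : ∀ m, firstCoeff w R i φ m ∈ locInt V e.dvol x₀ := by
    intro m p q
    have h1 := key (lin m p) (fun _ => q) (lin m p).contDiff contDiff_const
    simp only [fderiv_fun_const, Pi.zero_apply, zero_apply,
      inner_zero_right, Finset.sum_const_zero, mul_zero, add_zero, zero_add, map_zero,
      ContinuousLinearMap.fderiv, hlin2, inner_real_smul_left, ← Complex.real_smul,
      sum_kron_smul] at h1
    have h2 := h1.add (integrableAtFilter_const_mul
      (locInt_inner_continuousOn h0 ho hx (hc m p) continuousOn_const (q := fun _ => q)) (1 / 16))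
    -- The zeroth-order term, with its coordinate factor from the linear spinor, has been added back
    -- in `h2`; the factor 4 undoes the 1/4 in the integrand.
    convert integrableAtFilter_const_mul h2 4 using 1
    funext x
    simp only [Pi.add_apply, hlin]; ring
  refine ⟨fun m l p q => ?_, h1, h0⟩
  have h2 := key (lin m p) (lin l q) (lin m p).contDiff (lin l q).contDiff
  simp only [ContinuousLinearMap.fderiv, hlin2, inner_real_smul_left, inner_real_smul_right,
    LinearMap.map_smul_of_tower, ← Complex.real_smul, sum_kron_smul] at h2
  have h3 := locInt_inner_continuousOn (h1 m) ho hx (continuousOn_const (c := p)) (hc l q)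
  have h4 := locInt_inner_continuousOn_left (h1 l) ho hx (hc m p) (continuousOn_const (c := q))
  have h5 := locInt_inner_continuousOn h0 ho hx (hc m p) (hc l q)
  have h6 := ((h2.sub (integrableAtFilter_const_mul h3 (1 / 4))).sub
    (integrableAtFilter_const_mul h4 (1 / 4))).add (integrableAtFilter_const_mul h5 (1 / 16))
  refine integrableAtFilter_of_ae_eq Filter.univ_mem h6 (Filter.Eventually.of_forall fun x _ => ?_)
  simp only [Pi.add_apply, Pi.sub_apply, hlin]; ring

end Coefficients

/-! ### Gluing the local integrands and reducing to scalar conditions -/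

theorem coeffTwo_eq_form2 {n : ℕ} {V : Type*} [NormedAddCommGroup V] [InnerProductSpace ℂ V]
    (R : CliffordModule n V) (E F : Fin n → ℝ) :
    (2 : ℝ) • coeffTwo R.gam E F = form2 R.gam (fun c d => E c * F d - E d * F c) := by
  have h1 : coeffTwo R.gam E F = form2 R.gam (fun c d => E c * F d) := rfl
  have h2 := R.rel.form2_swap (fun c d => E c * F d)
  have h3 : form2 R.gam (fun c d => E c * F d - E d * F c)
      = form2 R.gam (fun c d => E c * F d) - form2 R.gam (fun c d => E d * F c) := by
    simp only [form2, sub_smul, Finset.sum_sub_distrib]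
  rw [h3, h2, h1]; module

theorem integrableAtFilter_const_mul_iff {M : Type*} [TopologicalSpace M] [MeasurableSpace M]
    {μ : Measure M} {x₀ : M} {f : M → ℝ} {r : ℝ} (hr : r ≠ 0) :
    IntegrableAtFilter (fun x => r * f x) (𝓝 x₀) μ ↔ IntegrableAtFilter f (𝓝 x₀) μ := by
  rw [show (fun x => r * f x) = r • f from rfl, integrableAtFilter_smul_iff, or_iff_right hr]

section Coefficients

variable {n : ℕ} {M : Type*} [TopologicalSpace M] [ChartedSpace (Euc n) M] {I : Type*}
  [IsManifold (𝓡 n) ∞ M] [SecondCountableTopology M] [MeasurableSpace M] [BorelSpace M]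
  {P : SpinStructure n M I} {e : SingularMetric P}

theorem locallyL1_iff (T : I → OpenPartialHomeomorph M (Euc n) → M → ℝ) :
    LocallyL1 e T ↔ ∀ i, ∀ φ ∈ IsManifold.maximalAtlas (𝓡 n) ∞ M, ∀ x ∈ P.dom i ∩ φ.source,
      IntegrableAtFilter (T i φ) (𝓝 x) e.dvol :=
  forall₃_congr fun i φ _ =>
    locallyIntegrableOn_iff_of_isOpen ((P.isOpen_dom i).inter φ.open_source)

variable {V : Type*} [NormedAddCommGroup V] [InnerProductSpace ℂ V]

theorem LichWellDefined.integrableAtFilter {R : CliffordModule n V} {w : LeviCivita e}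
    {f h : SpinorField P R} (H : LichWellDefined w f h) {i : I} {x₀ : M} (hx : x₀ ∈ P.dom i) :
    IntegrableAtFilter (lichIntegrand w f h i) (𝓝 x₀) e.dvol := by
  obtain ⟨F, hF, hi⟩ := H
  exact integrableAtFilter_of_ae_eq ((P.isOpen_dom i).mem_nhds hx) (hF.integrableAtFilter _) (hi i)

theorem lichIntegrand_eq_zero {R : CliffordModule n V} (w : LeviCivita e) (f h : SpinorField P R)
    {i : I} {x : M} (hf : f.val i =ᶠ[𝓝 x] fun _ => 0) : lichIntegrand w f h i x = 0 := by
  have hn : ∀ c, nabla w f i c x = 0 := fun c => by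
    have h1 : covDeriv w f i x (e.frame i c x) =
      (show V from mfderiv (𝓡 n) 𝓘(ℝ, V) (f.val i) x (e.frame i c x))
        + R.rep (spinLift (w.form i x (e.frame i c x))) (f.val i x) := rfl
    rw [nabla_eq_covDeriv, h1, hf.eq_of_nhds, map_zero, add_zero, hf.mfderiv_eq, mfderiv_const]
    rfl
  simp [lichIntegrand, dirac, hn]

variable [FiniteDimensional ℂ V]

/-- At each point the integrand is evaluated in some chosen trivialization. Gauge invariance makes
the result agree almost everywhere with each local expression. Compact support of the first spinor
then upgrades local integrability to integrability. -/
theorem lichWellDefined_of_integrableAtFilter [T2Space M] {R : CliffordModule n V}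
    {w : LeviCivita e} {f h : SpinorField P R}
    (H : ∀ i, ∀ x ∈ P.dom i, IntegrableAtFilter (lichIntegrand w f h i) (𝓝 x) e.dvol) :
    LichWellDefined w f h := by
  -- The gauge law holds only almost everywhere for each pair, so a countable subcover is needed to
  -- discard all exceptional null sets at once.
  obtain ⟨T, hTc, hT⟩ := TopologicalSpace.isOpen_iUnion_countable P.dom P.isOpen_dom
  have hcov : ∀ x, ∃ i ∈ T, x ∈ P.dom i := fun x => by
    obtain ⟨i, hi⟩ := P.cover x
    have : x ∈ ⋃ i ∈ T, P.dom i := by rw [hT]; exact mem_iUnion.2 ⟨i, hi⟩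
    simpa using this
  choose c hcT hcd using hcov
  have hF : ∀ i, ∀ᵐ x ∂e.dvol, x ∈ P.dom i →
      lichIntegrand w f h (c x) x = lichIntegrand w f h i x := fun i => by
    have h1 : ∀ᵐ x ∂e.dvol, ∀ j ∈ T, x ∈ P.dom j ∩ P.dom i →
        lichIntegrand w f h j x = lichIntegrand w f h i x := by
      refine (ae_ball_iff hTc).2 fun j _ => ?_
      filter_upwards [w.gauge j i] with x hx hxd
      exact lichIntegrand_trans w f h hxd (hx hxd)
    filter_upwards [h1] with x hx hxi
    exact hx _ (hcT x) ⟨hcd x, hxi⟩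
  refine ⟨fun x => lichIntegrand w f h (c x) x, ?_, hF⟩
  have hloc : LocallyIntegrable (fun x => lichIntegrand w f h (c x) x) e.dvol := fun x => by
    refine integrableAtFilter_of_ae_eq ((P.isOpen_dom (c x)).mem_nhds (hcd x)) (H _ x (hcd x)) ?_
    filter_upwards [hF (c x)] with y hy hyd
    exact (hy hyd).symm
  obtain ⟨K, hK, hfK⟩ := f.compact
  refine (integrableOn_iff_integrable_of_support_subset ?_).1 (hloc.integrableOn_isCompact hK)
  intro x hx
  by_contra hxK
  refine hx (lichIntegrand_eq_zero w f h ?_)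
  filter_upwards [(P.isOpen_dom (c x)).mem_nhds (hcd x), hK.isClosed.isOpen_compl.mem_nhds hxK]
    with y hy1 hy2
  exact hfK _ y hy1 hy2

theorem forall_lichWellDefined_iff [T2Space M] (w : LeviCivita e) (R : CliffordModule n V) :
    (∀ f h : SpinorField P R, LichWellDefined w f h) ↔
      ∀ i, ∀ φ ∈ IsManifold.maximalAtlas (𝓡 n) ∞ M, ∀ x ∈ P.dom i ∩ φ.source,
        CoeffIntegrable w R i φ x :=
  ⟨fun H _ _ hφ _ hx => coeffIntegrable_of_forall hφ hx fun f h =>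
      (H f h).integrableAtFilter hx.1,
    fun H f h => lichWellDefined_of_integrableAtFilter fun i x hx =>
      (H i (chartAt (Euc n) x) (IsManifold.chart_mem_maximalAtlas x) x
        ⟨hx, mem_chart_source _ x⟩).integrableAtFilter (IsManifold.chart_mem_maximalAtlas x)
          ⟨hx, mem_chart_source _ x⟩ f h⟩

variable [Nontrivial V]

theorem secondCoeff_mem_iff (R : CliffordModule n V) (i : I)
    (φ : OpenPartialHomeomorph M (Euc n)) (m l : Fin n) (x₀ : M) :
    secondCoeff e R i φ m l ∈ locInt V e.dvol x₀ ↔ ∀ c d, IntegrableAtFilter (fun x =>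
      e.frameComp i φ c m x * e.frameComp i φ d l x
        - e.frameComp i φ d m x * e.frameComp i φ c l x) (𝓝 x₀) e.dvol := by
  -- Doubling replaces the coefficient by its antisymmetrization without a factor 1/2. Zero scalar
  -- and degree-four parts are added to match the shape of the general criterion.
  rw [← Submodule.smul_mem_iff _ (two_ne_zero (α := ℝ))]
  have h1 : ((2 : ℝ) • secondCoeff e R i φ m l) = fun x => (0 : ℝ) • (1 : Module.End ℂ V)
      + form2 R.gam (fun c d => e.frameComp i φ c m x * e.frameComp i φ d l x
        - e.frameComp i φ d m x * e.frameComp i φ c l x)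
      + form4 R.gam (fun a b c d => (fun _ => (0 : ℝ)) ![a, b, c, d]) := by
    funext x
    rw [Pi.smul_apply, secondCoeff, coeffTwo_eq_form2]
    simp [form4]
  rw [h1, R.rel.mem_iff_coeff_mem (locInt V e.dvol x₀) locInt_mul_left locInt_mul_right
    (fun _ => 0) _ (fun x a b => by ring) (fun _ _ => 0)]
  have h2 : ∀ k : Fin 4 → Fin n, Alt (fun _ => (0 : ℝ)) k = 0 := fun k => by simp [Alt]
  simp only [smul_one_mem_locInt_iff, h2]
  have h0 : IntegrableAtFilter (fun _ : M => (0 : ℝ)) (𝓝 x₀) e.dvol := integrableAtFilter_zero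
  simp [h0]

theorem firstCoeff_mem_iff (w : LeviCivita e) (R : CliffordModule n V) {i : I}
    {φ : OpenPartialHomeomorph M (Euc n)} (m : Fin n) {x₀ : M} (hx : x₀ ∈ P.dom i) :
    firstCoeff w R i φ m ∈ locInt V e.dvol x₀ ↔
      IntegrableAtFilter (fun x => ∑ c, ∑ d, e.frameComp i φ c m x * w.comp i c d d x)
        (𝓝 x₀) e.dvol ∧
      (∀ a b, IntegrableAtFilter (fun x => - ∑ d, e.frameComp i φ a m x * w.comp i b d d x
          + ∑ d, e.frameComp i φ b m x * w.comp i a d d x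
          + ∑ c, e.frameComp i φ c m x * w.comp i c a b x
          - ∑ c, e.frameComp i φ c m x * w.comp i c b a x) (𝓝 x₀) e.dvol) ∧
      ∀ cdef : Fin 4 → Fin n, IntegrableAtFilter (fun x => Alt (fun k : Fin 4 → Fin n =>
          e.frameComp i φ (k 0) m x * w.comp i (k 2) (k 3) (k 1) x) cdef) (𝓝 x₀) e.dvol := by
  -- The expansion uses skewness of the connection form, which is available on the trivialization
  -- domain only; agreement near the point is enough.
  have h1 : firstCoeff w R i φ m =ᶠ[𝓝 x₀] fun x =>
      (-2 * ∑ c, ∑ d, e.frameComp i φ c m x * w.comp i c d d x) • (1 : Module.End ℂ V)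
      + form2 R.gam (fun a b => - ∑ d, e.frameComp i φ a m x * w.comp i b d d x
          + ∑ d, e.frameComp i φ b m x * w.comp i a d d x
          + ∑ c, e.frameComp i φ c m x * w.comp i c a b x
          - ∑ c, e.frameComp i φ c m x * w.comp i c b a x)
      + form4 R.gam (fun a b c d => (fun k : Fin 4 → Fin n =>
          e.frameComp i φ (k 0) m x * w.comp i (k 2) (k 3) (k 1) x) ![a, b, c, d]) := by
    filter_upwards [(P.isOpen_dom i).mem_nhds hx] with x hx
    exact R.rel.sum_g2_mul_form2 (W := fun a b c => w.comp i a b c x) (w.comp_skew hx)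
      (fun c => e.frameComp i φ c m x)
  rw [locInt_congr h1, R.rel.mem_iff_coeff_mem (locInt V e.dvol x₀) locInt_mul_left
    locInt_mul_right _ _ (fun x a b => by ring) (fun x k =>
      e.frameComp i φ (k 0) m x * w.comp i (k 2) (k 3) (k 1) x)]
  simp only [smul_one_mem_locInt_iff,
    integrableAtFilter_const_mul_iff (show (-2 : ℝ) ≠ 0 by norm_num)]

theorem zerothCoeff_mem_iff (w : LeviCivita e) (R : CliffordModule n V) {i : I} {x₀ : M}
    (hx : x₀ ∈ P.dom i) :
    zerothCoeff w R i ∈ locInt V e.dvol x₀ ↔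
      IntegrableAtFilter (fun x => ∑ a, ∑ b, ∑ c, (w.comp i a c a x * w.comp i c b b x
          - w.comp i a c b x * w.comp i c b a x)) (𝓝 x₀) e.dvol ∧
      ∀ mnpq : Fin 4 → Fin n, IntegrableAtFilter (fun x => Alt (fun k : Fin 4 → Fin n => ∑ r,
          (w.comp i (k 0) r r x * w.comp i (k 2) (k 3) (k 1) x
            - w.comp i (k 2) (k 3) r x * w.comp i r (k 1) (k 0) x
            + w.comp i (k 0) r (k 2) x * w.comp i r (k 1) (k 3) x)) mnpq) (𝓝 x₀) e.dvol := by
  -- The factor 1/4 removes the common factor 4 of the Clifford expansion, and the two-form part is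
  -- entered as zero.
  have h1 : ((1 / 4 : ℝ) • zerothCoeff w R i) =ᶠ[𝓝 x₀] fun x =>
      (∑ a, ∑ b, ∑ c, (w.comp i a c a x * w.comp i c b b x
          - w.comp i a c b x * w.comp i c b a x)) • (1 : Module.End ℂ V)
      + form2 R.gam (fun _ _ => 0)
      + form4 R.gam (fun a b c d => (fun k : Fin 4 → Fin n => ∑ r,
          (w.comp i (k 0) r r x * w.comp i (k 2) (k 3) (k 1) x
            - w.comp i (k 2) (k 3) r x * w.comp i r (k 1) (k 0) x
            + w.comp i (k 0) r (k 2) x * w.comp i r (k 1) (k 3) x)) ![a, b, c, d]) := by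
    filter_upwards [(P.isOpen_dom i).mem_nhds hx] with x hx
    have h2 := R.rel.sum_form2_mul_g2_mul_form2 (W := fun a b c => w.comp i a b c x)
      (w.comp_skew hx)
    have h3 : form2 R.gam (fun _ _ => (0 : ℝ)) = 0 := by simp [form2]
    rw [Pi.smul_apply, zerothCoeff, coeffZero, h2, h3, add_zero, smul_add, smul_smul, smul_smul,
      ← mul_assoc]
    norm_num
    rfl
  rw [← Submodule.smul_mem_iff _ (show (1 / 4 : ℝ) ≠ 0 by norm_num), locInt_congr h1,
    R.rel.mem_iff_coeff_mem (locInt V e.dvol x₀) locInt_mul_left locInt_mul_right _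
      (fun _ _ _ => 0) (fun x a b => by simp) (fun x k => ∑ r,
          (w.comp i (k 0) r r x * w.comp i (k 2) (k 3) (k 1) x
            - w.comp i (k 2) (k 3) r x * w.comp i r (k 1) (k 0) x
            + w.comp i (k 0) r (k 2) x * w.comp i r (k 1) (k 3) x))]
  have h0 : IntegrableAtFilter (fun _ : M => (0 : ℝ)) (𝓝 x₀) e.dvol := integrableAtFilter_zero
  simp only [smul_one_mem_locInt_iff, h0, implies_true, true_and]

end Coefficients

end

theorem theorem2 {n : ℕ} {M : Type*} [TopologicalSpace M] [T2Space M] [SecondCountableTopology M]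
    [ChartedSpace (Euc n) M] [IsManifold (𝓡 n) ∞ M] [MeasurableSpace M] [BorelSpace M]
    {I : Type*} (P : SpinStructure n M I) (e : SingularMetric P) (w : LeviCivita e)
    {V : Type*} [NormedAddCommGroup V] [InnerProductSpace ℂ V] [FiniteDimensional ℂ V]
    [Nontrivial V] (R : CliffordModule n V) :
    (∀ η ψ : SpinorField P R, LichWellDefined w η ψ) ↔
      -- e_c^μ e_d^ν - e_d^μ e_c^ν
      (∀ c d μ ν : Fin n, LocallyL1 e fun i φ x =>
        e.frameComp i φ c μ x * e.frameComp i φ d ν x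
          - e.frameComp i φ d μ x * e.frameComp i φ c ν x) ∧
      -- e_c^μ ω^{cd}_d
      (∀ μ : Fin n, LocallyL1 e fun i φ x =>
        ∑ c, ∑ d, e.frameComp i φ c μ x * w.comp i c d d x) ∧
      -- - e_a^μ ω_b^d_d + e_b^μ ω_a^d_d + e_c^μ ω^c_{ab} - e_c^μ ω^c_{ba}
      (∀ a b μ : Fin n, LocallyL1 e fun i φ x =>
        - ∑ d, e.frameComp i φ a μ x * w.comp i b d d x
          + ∑ d, e.frameComp i φ b μ x * w.comp i a d d x
          + ∑ c, e.frameComp i φ c μ x * w.comp i c a b x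
          - ∑ c, e.frameComp i φ c μ x * w.comp i c b a x) ∧
      -- Alt_{cdef} (e_c^μ ω_{efd})
      (∀ (μ : Fin n) (cdef : Fin 4 → Fin n), LocallyL1 e fun i φ x =>
        Alt (fun k : Fin 4 → Fin n =>
          e.frameComp i φ (k 0) μ x * w.comp i (k 2) (k 3) (k 1) x) cdef) ∧
      -- ω^a_{ca} ω^{cb}_b - ω^a_{cb} ω^{cb}_a
      (LocallyL1 e fun i _ x =>
        ∑ a, ∑ b, ∑ c, (w.comp i a c a x * w.comp i c b b x
          - w.comp i a c b x * w.comp i c b a x)) ∧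
      -- Alt_{mnpq} (ω_m^r_r ω_{pqn} - ω_{pqr} ω^r_{nm} + ω_{mrp} ω^r_{nq})
      (∀ mnpq : Fin 4 → Fin n, LocallyL1 e fun i _ x =>
        Alt (fun k : Fin 4 → Fin n => ∑ r,
          (w.comp i (k 0) r r x * w.comp i (k 2) (k 3) (k 1) x
            - w.comp i (k 2) (k 3) r x * w.comp i r (k 1) (k 0) x
            + w.comp i (k 0) r (k 2) x * w.comp i r (k 1) (k 3) x)) mnpq) := by
  rw [forall_lichWellDefined_iff]
  simp only [locallyL1_iff]
  constructor
  · intro H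
    have h1 := fun i φ hφ x hx m l => (secondCoeff_mem_iff R i φ m l x).1 ((H i φ hφ x hx).1 m l)
    have h2 := fun i φ hφ x (hx : x ∈ P.dom i ∩ φ.source) m =>
      (firstCoeff_mem_iff w R m hx.1).1 ((H i φ hφ x hx).2.1 m)
    have h3 := fun i φ hφ x (hx : x ∈ P.dom i ∩ φ.source) =>
      (zerothCoeff_mem_iff w R hx.1).1 (H i φ hφ x hx).2.2
    exact ⟨fun c d m l i φ hφ x hx => h1 i φ hφ x hx m l c d,
      fun m i φ hφ x hx => (h2 i φ hφ x hx m).1,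
      fun a b m i φ hφ x hx => (h2 i φ hφ x hx m).2.1 a b,
      fun m k i φ hφ x hx => (h2 i φ hφ x hx m).2.2 k,
      fun i φ hφ x hx => (h3 i φ hφ x hx).1,
      fun k i φ hφ x hx => (h3 i φ hφ x hx).2 k⟩
  · rintro ⟨h1, h2, h3, h4, h5, h6⟩ i φ hφ x hx
    exact ⟨fun m l => (secondCoeff_mem_iff R i φ m l x).2 fun c d => h1 c d m l i φ hφ x hx,
      fun m => (firstCoeff_mem_iff w R m hx.1).2 ⟨h2 m i φ hφ x hx,
        fun a b => h3 a b m i φ hφ x hx, fun k => h4 m k i φ hφ x hx⟩,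
      (zerothCoeff_mem_iff w R hx.1).2 ⟨h5 i φ hφ x hx, fun k => h6 k i φ hφ x hx⟩⟩
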